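/- Let $\mathcal S$ be a finite simplicial poset: a finite poset with least element $\hat 0$ such that every segment $[\hat 0,\sigma]$ is isomorphic to the poset of all subsets of a finite set. Its vertices $v_1,\dots,v_m$ are the minimal elements of $\mathcal S\setminus\{\hat 0\}$; for $\sigma\in\mathcal S$ put $J_\sigma=\{j\in[m] : v_j\le\sigma\}$. *The space.* The barycentric subdivision $\mathrm{Sd}(\Delta^{\mathcal S})$ of the geometric realization of $\mathcal S$ is the simplicial complex whose simplices are the nonempty chains in $\mathcal S\setminus\{\hat 0\}$. Let $Y^{\mathcal S}=u_0\,\mathrm{Sd}(\Delta^{\mathcal S})$ be its cone with apex $u_0$. For $\sigma\neq\hat 0$ let $F_\sigma\subseteq \mathrm{Sd}(\Delta^{\mathcal S})$ be the realization of $\{\tau:\tau\ge\sigma\}$, and let $\mathcal P=\{P_j=F_{v_j}\}_{j\in[m]}$. Put $P_{\cap J}=\bigcap_{j\in J}P_j$ for $J\subseteq[m]$, with $P_{\cap\varnothing}=Y^{\mathcal S}$; for $J\ne\varnothing$ it is the disjoint union of the $F_\sigma$ with $J_\sigma=J$. *The topological face ring.* Let $R^J\subseteq\mathbb Z[x_1,\dots,x_m]$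 be the span of the monomials in which exactly the variables $x_j$, $j\in J$, occur (so $R^\varnothing=\mathbb Z$), let $H^*$ be integral singular cohomology, and let $$\mathbb Z(Y^{\mathcal S},\mathcal P)=\bigoplus_{J\subseteq[m]}H^*(P_{\cap J})\otimes R^J,\qquad (\phi\otimes f)\star(\phi'\otimes f')=\big(\phi|_{P_{\cap(J\cup J')}}\cup\phi'|_{P_{\cap(J\cup J')}}\big)\otimes ff'$$ for $\phi\in H^*(P_{\cap J})$, $f\in R^J$, $\phi'\in H^*(P_{\cap J'})$, $f'\in R^{J'}$. *Stanley's face ring.* Let $\mathbb Z[\mathcal S]$ be the quotient of the polynomial ring $\mathbb Z[\mathbf v_\sigma:\sigma\in\mathcal S]$ by the ideal generated by $\mathbf v_{\hat 0}-1$ and all $\mathbf v_\sigma\mathbf v_\tau-\mathbf v_{\sigma\wedge\tau}\sum_{\eta\in\sigma\vee\tau}\mathbf v_\eta$, where $\sigma\vee\tau$ is the set of minimal common upper bounds of $\sigma$ and $\tau$, and $\sigma\wedge\tau$ is their greatest common lower bound; if $\sigma\vee\tau=\varnothing$ (then $\sigma\wedge\tau$ need not exist) the generator is $\mathbf v_\sigma\mathbf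 v_\tau$. **Proposition.** There is a ring isomorphism $\rho:\mathbb Z[\mathcal S]\to\mathbb Z(Y^{\mathcal S},\mathcal P)$ such that, for every chain $\sigma_1<\dots<\sigma_q$ ($q\ge1$) in $\mathcal S\setminus\{\hat 0\}$ and all integers $l_1,\dots,l_q\ge1$, $$\rho\big(\mathbf v_{\sigma_1}^{l_1}\cdots\mathbf v_{\sigma_q}^{l_q}\big)=e_{\sigma_q}\otimes f_{\sigma_1}^{l_1}\cdots f_{\sigma_q}^{l_q}\ \in\ H^*(P_{\cap J_{\sigma_q}})\otimes R^{J_{\sigma_q}},$$ where $f_\sigma=\prod_{j\in J_\sigma}x_j$, and where $e_\sigma\in H^*(P_{\cap J_\sigma})$ is the class that restricts to $1$ on the component $F_\sigma$ of $P_{\cap J_\sigma}$ and to $0$ on every other component. In particular, $\rho(\mathbf v_\sigma^l)=e_\sigma\otimes\big(\prod_{j\in J_\sigma}x_j\big)^l$ for all $\sigma\ne\hat 0$ and $l\ge1$. -/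

import Mathlib

open scoped DirectSum TensorProduct

noncomputable section

namespace FaceSpace

/-! ### The singular cohomology ring with integral coefficients -/

section SingularCohomology

variable {X Y Z : Type*} [TopologicalSpace X] [TopologicalSpace Y] [TopologicalSpace Z]

/-- Singular `n`-simplices of `X`: continuous maps from the standard topological `n`-simplex. -/
abbrev SingularSimplex (X : Type*) [TopologicalSpace X] (n : ℕ) : Type _ :=
  C(stdSimplex ℝ (Fin (n + 1)), X)

/-- Precomposition of a singular simplex with the affine map of standard simplices that is
given on the vertices by `θ`. -/
def SingularSimplex.pull {m n : ℕ} (θ : Fin (m + 1) → Fin (n + 1)) (s : SingularSimplex X n) :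
    SingularSimplex X m :=
  s.comp ⟨stdSimplex.map θ, stdSimplex.continuous_map θ⟩

theorem SingularSimplex.pull_pull {k m n : ℕ} (θ : Fin (m + 1) → Fin (n + 1))
    (η : Fin (k + 1) → Fin (m + 1)) (s : SingularSimplex X n) :
    SingularSimplex.pull η (SingularSimplex.pull θ s) = SingularSimplex.pull (θ ∘ η) s := by
  ext x
  simp [SingularSimplex.pull, stdSimplex.map_comp_apply]

theorem SingularSimplex.pull_id {n : ℕ} (s : SingularSimplex X n) :
    SingularSimplex.pull id s = s := by
  ext x
  simp [SingularSimplex.pull]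

theorem SingularSimplex.pull_comp {m n : ℕ} (θ : Fin (m + 1) → Fin (n + 1))
    (g : C(X, Y)) (s : SingularSimplex X n) :
    SingularSimplex.pull θ (g.comp s) = g.comp (SingularSimplex.pull θ s) := rfl

/-- Integral singular `n`-cochains: homomorphisms from the free abelian group on the singular
`n`-simplices to `ℤ`, that is, integral functions on the singular `n`-simplices. -/
abbrev Cochain (X : Type*) [TopologicalSpace X] (n : ℕ) : Type _ := SingularSimplex X n → ℤ

/-- The coboundary `(δ f)(s) = ∑ i, (-1) ^ i f (s ∘ dᵢ)`, with `dᵢ` the `i`-th face inclusion. -/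
def coboundary (X : Type*) [TopologicalSpace X] (n : ℕ) : Cochain X n →+ Cochain X (n + 1) where
  toFun f s := ∑ i : Fin (n + 2), (-1) ^ (i : ℕ) * f (SingularSimplex.pull i.succAbove s)
  map_zero' := by ext s; simp
  map_add' f g := by ext s; simp [mul_add, Finset.sum_add_distrib]

theorem coboundary_apply {n : ℕ} (f : Cochain X n) (s : SingularSimplex X (n + 1)) :
    coboundary X n f s =
      ∑ i : Fin (n + 2), (-1) ^ (i : ℕ) * f (SingularSimplex.pull i.succAbove s) := rfl

/-- Inclusion of the front `p`-face of an `n`-simplex. -/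
def frontFace {p n : ℕ} (h : p ≤ n) (i : Fin (p + 1)) : Fin (n + 1) := ⟨i, by omega⟩

/-- Inclusion of the back face of an `n`-simplex that is spanned by the vertices `p, …, p + q`. -/
def backFace {p q n : ℕ} (h : p + q = n) (i : Fin (q + 1)) : Fin (n + 1) := ⟨p + i, by omega⟩

/-- The cup product of cochains (front face, back face). The total degree `n = p + q` is kept as
a separate variable. -/
def cup {p q n : ℕ} (h : p + q = n) (f : Cochain X p) (g : Cochain X q) : Cochain X n :=
  fun s => f (SingularSimplex.pull (frontFace (by omega)) s) *
    g (SingularSimplex.pull (backFace h) s)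

theorem coboundary_cup {p q : ℕ} (f : Cochain X p) (g : Cochain X q) :
    coboundary X (p + q) (cup rfl f g) =
      cup (by omega) (coboundary X p f) g + (-1) ^ p • cup (by omega) f (coboundary X q g) := by
  ext s
  have hN : p + 1 + (q + 1) = p + q + 2 := by omega
  simp only [Pi.add_apply, Pi.smul_apply, cup, coboundary_apply, SingularSimplex.pull_pull]
  rw [← Equiv.sum_comp (finCongr hN), Fin.sum_univ_add, Fin.sum_univ_castSucc (n := p + 1),
    Fin.sum_univ_succ (n := q + 1), add_mul, mul_add, smul_add]
  have e1 : ∀ i : Fin (p + 1),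
      ((finCongr hN (Fin.castAdd (q + 1) i)).succAbove ∘ frontFace (p := p) (by omega) :
        Fin (p + 1) → Fin (p + q + 2)) = frontFace (by omega) ∘ i.castSucc.succAbove := by
    intro i; ext k
    simp only [frontFace, Fin.succAbove, Function.comp_apply, Fin.lt_def, finCongr_apply,
      Fin.val_castSucc, Fin.val_cast, Fin.val_castAdd]
    split_ifs <;> simp
  have e2 : ∀ i : Fin (p + 1),
      ((finCongr hN (Fin.castAdd (q + 1) i)).succAbove ∘ backFace (p := p) (q := q) rfl :
        Fin (q + 1) → Fin (p + q + 2)) = backFace (p := p + 1) (by omega) := by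
    intro i; ext k
    have := i.2
    simp only [backFace, Fin.succAbove, Function.comp_apply, Fin.lt_def, finCongr_apply,
      Fin.val_castSucc, Fin.val_cast, Fin.val_castAdd]
    split_ifs <;> simp <;> omega
  have e3 : ∀ i : Fin (q + 1),
      ((finCongr hN (Fin.natAdd (p + 1) i)).succAbove ∘ frontFace (p := p) (by omega) :
        Fin (p + 1) → Fin (p + q + 2)) = frontFace (by omega) := by
    intro i; ext k
    have := k.2
    simp only [frontFace, Fin.succAbove, Function.comp_apply, Fin.lt_def, finCongr_apply,
      Fin.val_castSucc, Fin.val_cast, Fin.val_natAdd]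
    split_ifs
    · rfl
    · simp; omega
  have e4 : ∀ i : Fin (q + 1),
      ((finCongr hN (Fin.natAdd (p + 1) i)).succAbove ∘ backFace (p := p) (q := q) rfl :
        Fin (q + 1) → Fin (p + q + 2)) =
        backFace (p := p) (q := q + 1) (by omega) ∘ i.succ.succAbove := by
    intro i; ext k
    simp only [backFace, Fin.succAbove, Function.comp_apply, Fin.lt_def, finCongr_apply,
      Fin.val_castSucc, Fin.val_cast, Fin.val_natAdd, Fin.val_succ]
    split_ifs <;> simp <;> omega
  have e5 : (frontFace (p := p + 1) (n := p + q + 1) (by omega) ∘ (Fin.last (p + 1)).succAbove :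
      Fin (p + 1) → Fin (p + q + 2)) = frontFace (by omega) := by
    ext k; simp [frontFace]
  have e6 : (backFace (p := p) (q := q + 1) (n := p + q + 1) (by omega) ∘
      (0 : Fin (q + 2)).succAbove :
      Fin (q + 1) → Fin (p + q + 2)) = backFace (p := p + 1) (by omega) := by
    ext k; simp [backFace]; omega
  simp only [e1, e2, e3, e4, e5, e6, Finset.sum_mul, Finset.mul_sum, Finset.smul_sum]
  simp only [finCongr_apply, Fin.val_cast, Fin.val_castAdd, Fin.val_natAdd, Fin.val_castSucc,
    Fin.val_last, Fin.val_succ, Fin.val_zero, smul_eq_mul]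
  have h1 : ∀ i : Fin (q + 1), (-1 : ℤ) ^ (p + 1 + (i : ℕ)) = (-1) ^ p * (-1) ^ ((i : ℕ) + 1) :=
    fun i => by ring
  simp only [h1, mul_assoc, pow_succ (-1 : ℤ) p, mul_left_comm _ (f _)]
  ring

/-- The group of singular `n`-cocycles. -/
def cocycles (X : Type*) [TopologicalSpace X] (n : ℕ) : AddSubgroup (Cochain X n) :=
  (coboundary X n).ker

/-- The group of singular `n`-coboundaries. -/
def coboundaries (X : Type*) [TopologicalSpace X] : (n : ℕ) → AddSubgroup (Cochain X n)
  | 0 => ⊥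
  | n + 1 => (coboundary X n).range

/-- The singular cohomology group `Hⁿ(X; ℤ)`: cocycles modulo coboundaries. -/
abbrev Cohomology (X : Type*) [TopologicalSpace X] (n : ℕ) : Type _ :=
  cocycles X n ⧸ (coboundaries X n).addSubgroupOf (cocycles X n)

theorem mem_cocycles {n : ℕ} {f : Cochain X n} : f ∈ cocycles X n ↔ coboundary X n f = 0 :=
  Iff.rfl

theorem cup_zero {p q n : ℕ} (h : p + q = n) (f : Cochain X p) : cup h f (0 : Cochain X q) = 0 := by
  ext s; simp [cup]

theorem zero_cup {p q n : ℕ} (h : p + q = n) (g : Cochain X q) : cup h (0 : Cochain X p) g = 0 := by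
  ext s; simp [cup]

theorem cup_add {p q n : ℕ} (h : p + q = n) (f : Cochain X p) (g g' : Cochain X q) :
    cup h f (g + g') = cup h f g + cup h f g' := by
  ext s; simp [cup, mul_add]

theorem add_cup {p q n : ℕ} (h : p + q = n) (f f' : Cochain X p) (g : Cochain X q) :
    cup h (f + f') g = cup h f g + cup h f' g := by
  ext s; simp [cup, add_mul]

theorem cup_mem_cocycles {p q n : ℕ} (h : p + q = n) {f : Cochain X p} {g : Cochain X q}
    (hf : f ∈ cocycles X p) (hg : g ∈ cocycles X q) : cup h f g ∈ cocycles X n := by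
  subst h
  rw [mem_cocycles] at *
  rw [coboundary_cup, hf, hg, cup_zero, zero_cup]
  simp

theorem cup_mem_coboundaries_left {p q n : ℕ} (h : p + q = n) {f : Cochain X p} {g : Cochain X q}
    (hf : f ∈ coboundaries X p) (hg : g ∈ cocycles X q) : cup h f g ∈ coboundaries X n := by
  cases p with
  | zero =>
    have : f = 0 := hf
    rw [this, zero_cup]
    exact zero_mem _
  | succ p =>
    obtain ⟨a, rfl⟩ := hf
    obtain rfl : p + q + 1 = n := by omega
    refine ⟨cup rfl a g, ?_⟩
    rw [coboundary_cup, mem_cocycles.1 hg, cup_zero]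
    simp

theorem cup_mem_coboundaries_right {p q n : ℕ} (h : p + q = n) {f : Cochain X p} {g : Cochain X q}
    (hf : f ∈ cocycles X p) (hg : g ∈ coboundaries X q) : cup h f g ∈ coboundaries X n := by
  cases q with
  | zero =>
    have : g = 0 := hg
    rw [this, cup_zero]
    exact zero_mem _
  | succ q =>
    obtain ⟨a, rfl⟩ := hg
    obtain rfl : p + q + 1 = n := by omega
    refine ⟨(-1) ^ p • cup rfl f a, ?_⟩
    rw [map_zsmul, coboundary_cup, mem_cocycles.1 hf, zero_cup, zero_add, smul_smul, ← mul_pow]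
    simp

/-- The cup product of cocycles. -/
def cocycleCup (X : Type*) [TopologicalSpace X] (p q : ℕ) :
    cocycles X p →+ cocycles X q →+ cocycles X (p + q) :=
  AddMonoidHom.mk' (fun f => AddMonoidHom.mk'
      (fun g => ⟨cup rfl f.1 g.1, cup_mem_cocycles rfl f.2 g.2⟩)
      (fun g g' => Subtype.ext (cup_add rfl f.1 g.1 g'.1)))
    (fun f f' => AddMonoidHom.ext fun g => Subtype.ext (add_cup rfl f.1 f'.1 g.1))

/-- The cup product of cohomology classes. -/
def cohomologyCup (X : Type*) [TopologicalSpace X] (p q : ℕ) :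
    Cohomology X p →+ Cohomology X q →+ Cohomology X (p + q) :=
  QuotientAddGroup.lift _
    (AddMonoidHom.mk' (fun f => QuotientAddGroup.lift _
        ((QuotientAddGroup.mk' _).comp (cocycleCup X p q f))
        (fun g hg => (QuotientAddGroup.eq_zero_iff _).2
          (cup_mem_coboundaries_right rfl f.2 hg)))
      (fun f f' => by
        refine QuotientAddGroup.addMonoidHom_ext _ (AddMonoidHom.ext fun g => ?_)
        have e : cocycleCup X p q (f + f') g = cocycleCup X p q f g + cocycleCup X p q f' g := by
          rw [map_add, AddMonoidHom.add_apply]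
        exact congrArg (QuotientAddGroup.mk' ((coboundaries X (p + q)).addSubgroupOf _)) e))
    (fun f hf => by
      refine QuotientAddGroup.addMonoidHom_ext _ (AddMonoidHom.ext fun g => ?_)
      exact (QuotientAddGroup.eq_zero_iff _).2 (cup_mem_coboundaries_left rfl hf g.2))

/-- The constant `0`-cocycle `1`. -/
def oneCocycle (X : Type*) [TopologicalSpace X] : cocycles X 0 :=
  ⟨fun _ => 1, by
    rw [mem_cocycles]
    ext s
    simp [coboundary_apply, Fin.sum_univ_two]⟩

theorem cohomology_mk_eq {n m : ℕ} (h : n = m) (a : cocycles X n) (b : cocycles X m)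
    (hab : ∀ s, a.1 (SingularSimplex.pull (Fin.cast (by omega)) s) = b.1 s) :
    GradedMonoid.mk (A := Cohomology X) n (QuotientAddGroup.mk a) =
      GradedMonoid.mk (A := Cohomology X) m (QuotientAddGroup.mk b) := by
  subst h
  congr 2
  ext s
  rw [← hab]
  exact congrArg a.1 (SingularSimplex.pull_id s).symm

instance : GradedMonoid.GMul (Cohomology X) where
  mul {p q} a b := cohomologyCup X p q a b

instance : GradedMonoid.GOne (Cohomology X) where
  one := QuotientAddGroup.mk (oneCocycle X)

instance : DirectSum.GRing (Cohomology X) where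
  mul_zero a := map_zero (cohomologyCup X _ _ a)
  zero_mul {p q} b := by
    change cohomologyCup X p q 0 b = 0
    rw [map_zero, AddMonoidHom.zero_apply]
  mul_add a b c := map_add (cohomologyCup X _ _ a) b c
  add_mul {p q} a b c := by
    change cohomologyCup X p q (a + b) c = cohomologyCup X p q a c + cohomologyCup X p q b c
    rw [map_add, AddMonoidHom.add_apply]
  one_mul := by
    rintro ⟨n, a⟩
    induction a using QuotientAddGroup.induction_on with | H a => ?_
    refine cohomology_mk_eq (zero_add n) (cocycleCup X 0 n (oneCocycle X) a) a fun s => ?_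
    change 1 * a.1 _ = _
    rw [one_mul, SingularSimplex.pull_pull]
    convert congrArg a.1 (SingularSimplex.pull_id s) using 3
    ext k; simp [backFace]
  mul_one := by
    rintro ⟨n, a⟩
    induction a using QuotientAddGroup.induction_on with | H a => ?_
    refine cohomology_mk_eq (add_zero n) (cocycleCup X n 0 a (oneCocycle X)) a fun s => ?_
    change a.1 _ * 1 = _
    rw [mul_one, SingularSimplex.pull_pull]
    convert congrArg a.1 (SingularSimplex.pull_id s) using 3
    ext k; simp [frontFace]
  mul_assoc := by
    rintro ⟨p, a⟩ ⟨q, b⟩ ⟨r, c⟩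
    induction a using QuotientAddGroup.induction_on with | H a => ?_
    induction b using QuotientAddGroup.induction_on with | H b => ?_
    induction c using QuotientAddGroup.induction_on with | H c => ?_
    refine cohomology_mk_eq (add_assoc p q r)
      (cocycleCup X (p + q) r (cocycleCup X p q a b) c)
      (cocycleCup X p (q + r) a (cocycleCup X q r b c)) fun s => ?_
    change a.1 _ * b.1 _ * c.1 _ = a.1 _ * (b.1 _ * c.1 _)
    simp only [SingularSimplex.pull_pull, mul_assoc]
    have e : (Fin.cast (by omega) ∘ backFace (p := p + q) (q := r) rfl :
        Fin (r + 1) → Fin (p + (q + r) + 1)) =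
        backFace (p := p) (q := q + r) rfl ∘ backFace (p := q) (q := r) rfl := by
      ext k; simp [backFace, add_assoc]
    rw [e]
    rfl
  natCast n := n • QuotientAddGroup.mk (oneCocycle X)
  natCast_zero := zero_smul _ _
  natCast_succ n := succ_nsmul _ n
  intCast n := n • QuotientAddGroup.mk (oneCocycle X)
  intCast_ofNat n := natCast_zsmul _ n
  intCast_negSucc_ofNat n := negSucc_zsmul _ n

/-- The integral singular cohomology ring `H^*(X) = ⨁ₙ Hⁿ(X; ℤ)`, with the cup product. -/
def CohomologyRing (X : Type*) [TopologicalSpace X] : Type _ := ⨁ n, Cohomology X n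

instance : Ring (CohomologyRing X) := inferInstanceAs (Ring (⨁ n, Cohomology X n))

/-- The inclusion of `Hⁿ(X)` into the cohomology ring. -/
def CohomologyRing.of (X : Type*) [TopologicalSpace X] (n : ℕ) :
    Cohomology X n →+ CohomologyRing X :=
  DirectSum.of (Cohomology X) n

theorem CohomologyRing.ringHom_ext {R : Type*} [Ring R] {F G : CohomologyRing X →+* R}
    (h : ∀ n (a : cocycles X n), F (CohomologyRing.of X n (QuotientAddGroup.mk a)) =
      G (CohomologyRing.of X n (QuotientAddGroup.mk a))) : F = G := by
  refine DirectSum.ringHom_ext (A := Cohomology X) (f := F) (g := G) fun n a => ?_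
  induction a using QuotientAddGroup.induction_on with | H a => ?_
  exact h n a

/-! Functoriality. -/

/-- The map of cochains that is induced by a continuous map. -/
def cochainMap (g : C(X, Y)) (n : ℕ) : Cochain Y n →+ Cochain X n where
  toFun f s := f (g.comp s)
  map_zero' := rfl
  map_add' _ _ := rfl

theorem coboundary_cochainMap (g : C(X, Y)) (n : ℕ) (f : Cochain Y n) :
    coboundary X n (cochainMap g n f) = cochainMap g (n + 1) (coboundary Y n f) := rfl

theorem cochainMap_mem_cocycles (g : C(X, Y)) {n : ℕ} {f : Cochain Y n} (hf : f ∈ cocycles Y n) :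
    cochainMap g n f ∈ cocycles X n := by
  rw [mem_cocycles, coboundary_cochainMap, mem_cocycles.1 hf, map_zero]

theorem cochainMap_mem_coboundaries (g : C(X, Y)) {n : ℕ} {f : Cochain Y n}
    (hf : f ∈ coboundaries Y n) : cochainMap g n f ∈ coboundaries X n := by
  cases n with
  | zero =>
    have : f = 0 := hf
    rw [this, map_zero]
    exact zero_mem _
  | succ n =>
    obtain ⟨a, rfl⟩ := hf
    exact ⟨cochainMap g n a, coboundary_cochainMap g n a⟩

/-- The map of cocycles that is induced by a continuous map. -/
def cocycleMap (g : C(X, Y)) (n : ℕ) : cocycles Y n →+ cocycles X n :=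
  AddMonoidHom.mk' (fun f => ⟨cochainMap g n f.1, cochainMap_mem_cocycles g f.2⟩)
    (fun _ _ => rfl)

/-- The map `g^* : Hⁿ(Y) → Hⁿ(X)` that is induced by a continuous map `g : X → Y`. -/
def cohomologyMap (g : C(X, Y)) (n : ℕ) : Cohomology Y n →+ Cohomology X n :=
  QuotientAddGroup.map _ _ (cocycleMap g n) (fun _ hf => cochainMap_mem_coboundaries g hf)

/-- The ring homomorphism `g^* : H^*(Y) → H^*(X)` that is induced by a continuous map. -/
def CohomologyRing.map (g : C(X, Y)) : CohomologyRing Y →+* CohomologyRing X :=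
  DirectSum.toSemiring (fun n => (DirectSum.of (Cohomology X) n).comp (cohomologyMap g n)) rfl
    (by
      intro p q a b
      induction a using QuotientAddGroup.induction_on with | H a => ?_
      induction b using QuotientAddGroup.induction_on with | H b => ?_
      exact (DirectSum.of_mul_of (A := Cohomology X)
        (QuotientAddGroup.mk (cocycleMap g p a)) (QuotientAddGroup.mk (cocycleMap g q b))).symm)

theorem CohomologyRing.map_of (g : C(X, Y)) (n : ℕ) (a : Cohomology Y n) :
    CohomologyRing.map g (CohomologyRing.of Y n a) =
      CohomologyRing.of X n (cohomologyMap g n a) :=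
  DirectSum.toSemiring_of _ _ _ _ _

theorem CohomologyRing.map_id : CohomologyRing.map (ContinuousMap.id X) = RingHom.id _ :=
  CohomologyRing.ringHom_ext fun _ _ => CohomologyRing.map_of _ _ _

theorem CohomologyRing.map_comp (h : C(Y, Z)) (g : C(X, Y)) :
    (CohomologyRing.map g).comp (CohomologyRing.map h) = CohomologyRing.map (h.comp g) := by
  refine CohomologyRing.ringHom_ext fun n a => ?_
  rw [RingHom.comp_apply, CohomologyRing.map_of, CohomologyRing.map_of, CohomologyRing.map_of]
  rfl

/-- Restriction `H^*(B) → H^*(A)` for subspaces `A ⊆ B`. -/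
def restrict {A B : Set X} (h : A ⊆ B) : CohomologyRing B →+* CohomologyRing A :=
  CohomologyRing.map ⟨Set.inclusion h, continuous_inclusion h⟩

theorem restrict_refl {A : Set X} (a : CohomologyRing A) : restrict (Set.Subset.refl A) a = a :=
  RingHom.congr_fun CohomologyRing.map_id a

theorem restrict_restrict {A B C : Set X} (h : A ⊆ B) (h' : B ⊆ C) (a : CohomologyRing C) :
    restrict h (restrict h' a) = restrict (h.trans h') a :=
  RingHom.congr_fun (CohomologyRing.map_comp _ _) a

end SingularCohomology

/-! ### The topological face ring of a space with faces -/

section TopologicalFaceRing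

/-- A panel structure on a space `Y`: a locally finite family of closed subspaces. -/
structure PanelStructure (ι : Type*) (Y : Type*) [TopologicalSpace Y] where
  /-- The panels. -/
  panel : ι → Set Y
  isClosed_panel : ∀ j, IsClosed (panel j)
  locallyFinite_panel : LocallyFinite panel

variable {ι : Type*} {Y : Type*} [TopologicalSpace Y]

/-- The intersection `P_{∩J}` of the panels with index in `J`; it is all of `Y` for `J = ∅`. -/
def PanelStructure.inter (P : PanelStructure ι Y) (J : Finset ι) : Set Y :=
  ⋂ j ∈ J, P.panel j

theorem PanelStructure.inter_anti (P : PanelStructure ι Y) {I J : Finset ι} (h : I ⊆ J) :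
    P.inter J ⊆ P.inter I :=
  Set.biInter_subset_biInter_left h

/-- The finite subsets of `ι`, regarded as an additive monoid under union. -/
def IndexSet (ι : Type*) : Type _ := Finset ι

/-- An element of `IndexSet ι` as a finite set. -/
abbrev IndexSet.toFinset (J : IndexSet ι) : Finset ι := J

instance : DecidableEq (IndexSet ι) := Classical.decEq _

instance : Zero (IndexSet ι) := ⟨(∅ : Finset ι)⟩

open Classical in
instance : Add (IndexSet ι) := ⟨fun I J => (I.toFinset ∪ J.toFinset : Finset ι)⟩

instance : AddCommMonoid (IndexSet ι) where
  add_assoc I J K := by classical exact Finset.union_assoc I.toFinset J.toFinset K.toFinset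
  zero_add I := by classical exact Finset.empty_union I.toFinset
  add_zero I := by classical exact Finset.union_empty I.toFinset
  add_comm I J := by classical exact Finset.union_comm I.toFinset J.toFinset
  nsmul := nsmulRec

theorem IndexSet.subset_add_left (I J : IndexSet ι) : I.toFinset ⊆ (I + J).toFinset := by
  classical exact Finset.subset_union_left

theorem IndexSet.subset_of_eq {I J : IndexSet ι} (h : I = J) : I.toFinset ⊆ J.toFinset := by
  rw [h]

theorem IndexSet.subset_add_right (I J : IndexSet ι) : J.toFinset ⊆ (I + J).toFinset := by
  classical exact Finset.subset_union_right

/-- The span `R^J` of all monomials in the polynomial ring `ℤ[x_j : j ∈ ι]` in which exactly the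
variables `x_j` with `j ∈ J` occur. For `J = ∅` it consists of the constants. -/
def exactMonomials (J : Finset ι) : Submodule ℤ (MvPolynomial ι ℤ) :=
  Submodule.span ℤ {p | ∃ d : ι →₀ ℕ, d.support = J ∧ p = MvPolynomial.monomial d 1}

theorem one_mem_exactMonomials :
    (1 : MvPolynomial ι ℤ) ∈ exactMonomials (0 : IndexSet ι).toFinset :=
  Submodule.subset_span ⟨0, rfl, rfl⟩

theorem mul_mem_exactMonomials {I J : IndexSet ι} {f g : MvPolynomial ι ℤ}
    (hf : f ∈ exactMonomials I.toFinset) (hg : g ∈ exactMonomials J.toFinset) :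
    f * g ∈ exactMonomials (I + J).toFinset := by
  classical
  have h := Submodule.mul_mem_mul hf hg
  rw [exactMonomials, exactMonomials, Submodule.span_mul_span] at h
  refine Submodule.span_mono ?_ h
  rintro _ ⟨_, ⟨d, hd, rfl⟩, _, ⟨d', hd', rfl⟩, rfl⟩
  refine ⟨d + d', ?_, ?_⟩
  · have e : (d + d').support = d.support ∪ d'.support := by
      ext a; simp; omega
    rw [e, hd, hd']
    congr!
  · simp

variable (P : PanelStructure ι Y)

/-- The summand `H^*(P_{∩J}) ⊗ R^J` of the topological face ring. -/
abbrev FaceSummand (J : IndexSet ι) : Type _ :=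
  CohomologyRing (P.inter J.toFinset) ⊗[ℤ] exactMonomials J.toFinset

/-- The product `(φ, φ') ↦ κ^*(φ) ∪ κ^*(φ')` from `H^*(P_{∩I}) × H^*(P_{∩J})` to
`H^*(P_{∩(I ∪ J)})`. -/
def interCup (I J : IndexSet ι) :
    CohomologyRing (P.inter I.toFinset) →ₗ[ℤ] CohomologyRing (P.inter J.toFinset) →ₗ[ℤ]
      CohomologyRing (P.inter (I + J).toFinset) :=
  (LinearMap.mul ℤ (CohomologyRing (P.inter (I + J).toFinset))).compl₁₂
    (restrict (P.inter_anti (IndexSet.subset_add_left I J))).toAddMonoidHom.toIntLinearMap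
    (restrict (P.inter_anti (IndexSet.subset_add_right I J))).toAddMonoidHom.toIntLinearMap

/-- The product of polynomials as a map `R^I × R^J → R^{I ∪ J}`. -/
def monomialMul (I J : IndexSet ι) :
    exactMonomials I.toFinset →ₗ[ℤ] exactMonomials J.toFinset →ₗ[ℤ]
      exactMonomials (I + J).toFinset :=
  LinearMap.mk₂ ℤ (fun f g => ⟨f.1 * g.1, mul_mem_exactMonomials f.2 g.2⟩)
    (fun _ _ _ => Subtype.ext (add_mul _ _ _)) (fun _ _ _ => Subtype.ext (smul_mul_assoc _ _ _))
    (fun _ _ _ => Subtype.ext (mul_add _ _ _)) (fun _ _ _ => Subtype.ext (mul_smul_comm _ _ _))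

/-- The product `(φ ⊗ f) ⋆ (φ' ⊗ f') = (κ^*(φ) ∪ κ^*(φ')) ⊗ f f'`. -/
def starMul (I J : IndexSet ι) :
    FaceSummand P I →ₗ[ℤ] FaceSummand P J →ₗ[ℤ] FaceSummand P (I + J) :=
  TensorProduct.map₂ (interCup P I J) (monomialMul I J)

/-- The unit `1 ⊗ 1` in the summand of the empty set. -/
def starOne : FaceSummand P 0 := 1 ⊗ₜ ⟨1, one_mem_exactMonomials⟩

theorem starMul_tmul {I J : IndexSet ι} (a : CohomologyRing (P.inter I.toFinset))
    (f : exactMonomials I.toFinset) (b : CohomologyRing (P.inter J.toFinset))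
    (g : exactMonomials J.toFinset) :
    starMul P I J (a ⊗ₜ f) (b ⊗ₜ g) =
      (restrict (P.inter_anti (IndexSet.subset_add_left I J)) a *
        restrict (P.inter_anti (IndexSet.subset_add_right I J)) b) ⊗ₜ
          ⟨f.1 * g.1, mul_mem_exactMonomials f.2 g.2⟩ := rfl

/-- The identification of the summands of equal index sets. -/
def castSummand {I J : IndexSet ι} (h : I = J) : FaceSummand P I →ₗ[ℤ] FaceSummand P J :=
  TensorProduct.map
    (restrict (P.inter_anti (IndexSet.subset_of_eq h))).toAddMonoidHom.toIntLinearMap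
    (Submodule.inclusion (by rw [h]))

theorem castSummand_tmul {I J : IndexSet ι} (h : I = J) (a : CohomologyRing (P.inter I.toFinset))
    (f : exactMonomials I.toFinset) :
    castSummand P h (a ⊗ₜ f) = restrict (P.inter_anti (IndexSet.subset_of_eq h)) a ⊗ₜ
      ⟨f.1, h ▸ f.2⟩ := rfl

theorem mk_castSummand {I J : IndexSet ι} (h : I = J) (x : FaceSummand P I) :
    GradedMonoid.mk (A := FaceSummand P) J (castSummand P h x) = GradedMonoid.mk I x := by
  subst h
  congr 1
  induction x using TensorProduct.induction_on with
  | zero => rw [map_zero]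
  | tmul a f => rw [castSummand_tmul, restrict_refl]
  | add x y hx hy => rw [map_add, hx, hy]

instance : GradedMonoid.GMul (FaceSummand P) where
  mul x y := starMul P _ _ x y

instance : GradedMonoid.GOne (FaceSummand P) where
  one := starOne P

instance : DirectSum.GRing (FaceSummand P) where
  mul_zero {I J} x := map_zero (starMul P I J x)
  zero_mul {I J} y := LinearMap.map_zero₂ (starMul P I J) y
  mul_add {I J} x y z := map_add (starMul P I J x) y z
  add_mul {I J} x y z := LinearMap.map_add₂ (starMul P I J) x y z
  one_mul := by
    rintro ⟨I, x⟩
    refine (mk_castSummand P (zero_add I) (starMul P 0 I (starOne P) x)).symm.trans ?_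
    congr 1
    induction x using TensorProduct.induction_on with
    | zero => simp
    | tmul a f =>
      rw [starOne, starMul_tmul, castSummand_tmul]
      simp [restrict_restrict, restrict_refl]
    | add x y hx hy => rw [map_add, map_add, hx, hy]
  mul_one := by
    rintro ⟨I, x⟩
    refine (mk_castSummand P (add_zero I) (starMul P I 0 x (starOne P))).symm.trans ?_
    congr 1
    induction x using TensorProduct.induction_on with
    | zero => simp
    | tmul a f =>
      rw [starOne, starMul_tmul, castSummand_tmul]
      simp [restrict_restrict, restrict_refl]
    | add x y hx hy => rw [LinearMap.map_add₂, map_add, hx, hy]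
  mul_assoc := by
    rintro ⟨I, x⟩ ⟨J, y⟩ ⟨K, z⟩
    refine (mk_castSummand P (add_assoc I J K)
      (starMul P (I + J) K (starMul P I J x y) z)).symm.trans ?_
    refine congrArg (GradedMonoid.mk (A := FaceSummand P) (I + (J + K)))
      (?_ : _ = starMul P I (J + K) x (starMul P J K y z))
    induction x using TensorProduct.induction_on with
    | zero => simp
    | add x x' hx hx' => simp only [map_add, LinearMap.add_apply, hx, hx']
    | tmul a f =>
    induction y using TensorProduct.induction_on with
    | zero => simp
    | add y y' hy hy' => simp only [map_add, LinearMap.add_apply, hy, hy']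
    | tmul b g =>
    induction z using TensorProduct.induction_on with
    | zero => simp
    | add z z' hz hz' => simp only [map_add, hz, hz']
    | tmul c k =>
      rw [starMul_tmul, starMul_tmul, castSummand_tmul, starMul_tmul, starMul_tmul]
      simp only [map_mul, restrict_restrict, mul_assoc]
  natCast n := n • starOne P
  natCast_zero := zero_smul _ _
  natCast_succ n := succ_nsmul _ n
  intCast n := n • starOne P
  intCast_ofNat n := natCast_zsmul _ n
  intCast_negSucc_ofNat n := negSucc_zsmul _ n

/-- The topological face ring `ℤ(Y, P) = ⨁_J H^*(P_{∩J}) ⊗ R^J` with the product `⋆`. -/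
def TopologicalFaceRing : Type _ := ⨁ J : IndexSet ι, FaceSummand P J

instance : Ring (TopologicalFaceRing P) := inferInstanceAs (Ring (⨁ J : IndexSet ι, FaceSummand P J))

/-- The inclusion of the summand `H^*(P_{∩J}) ⊗ R^J`. -/
def TopologicalFaceRing.of (J : Finset ι) :
    CohomologyRing (P.inter J) ⊗[ℤ] exactMonomials J →+ TopologicalFaceRing P :=
  DirectSum.of (FaceSummand P) J

end TopologicalFaceRing

/-! ### Simplicial posets -/

section SimplicialPoset

/-- A poset with least element `⊥` is simplicial if every segment `[⊥, σ]` is the face poset of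
a simplex (with the empty face), that is, the poset of all subsets of a finite set. -/
def IsSimplicialPoset (S : Type*) [PartialOrder S] [OrderBot S] : Prop :=
  ∀ σ : S, ∃ n : ℕ, Nonempty (Set.Icc ⊥ σ ≃o Finset (Fin n))

variable (S : Type*) [PartialOrder S] [OrderBot S] [Fintype S]

/-- The vertices: elements that cover the least element. -/
abbrev Vertex : Type _ := {v : S // IsAtom v}

/-- The elements that correspond to nonempty simplices. -/
abbrev Simplex : Type _ := {σ : S // σ ≠ ⊥}

variable {S} in
open Classical in
/-- The vertex set `V(Δ^σ)`. -/
def vertexSet (σ : S) : Finset (Vertex S) := Finset.univ.filter fun v => v.1 ≤ σ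

variable {S} in
/-- The product of the variables of the vertices of `σ`. -/
def vertexMonomial (σ : S) : MvPolynomial (Vertex S) ℤ := ∏ v ∈ vertexSet σ, MvPolynomial.X v

open Classical in
/-- The underlying set of the cone `Y^S` with apex `u₀` over the barycentric subdivision of the
geometric realization of `S`. The simplices of the barycentric subdivision are the nonempty finite
chains of nonempty simplices. A point of the cone is given by its barycentric coordinates, where
`none` stands for the apex `u₀`. -/
def coneSet : Set (Option (Simplex S) → ℝ) :=
  {t | t ∈ stdSimplex ℝ (Option (Simplex S)) ∧
    IsChain (· ≤ ·) {σ : Simplex S | t (some σ) ≠ 0}}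

/-- The space `Y^S`, with the topology induced from Euclidean space. -/
abbrev ConeSpace : Type _ := coneSet S

variable {S} in
/-- The face `F_σ`, the realization of `S_{≥ σ}`: it consists of the simplices of the
barycentric subdivision all of whose vertices are `≥ σ`. -/
def face (σ : Simplex S) : Set (ConeSpace S) :=
  {t | t.1 none = 0 ∧ ∀ τ : Simplex S, t.1 (some τ) ≠ 0 → σ ≤ τ}

variable {S} in
/-- A vertex as a nonempty simplex. -/
def Vertex.toSimplex (v : Vertex S) : Simplex S := ⟨v.1, v.2.1⟩

variable {S} in
theorem isClosed_face (σ : Simplex S) : IsClosed (face σ) := by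
  have h : face σ = {t : ConeSpace S | t.1 none = 0} ∩
      ⋂ τ : Simplex S, ⋂ _ : ¬ σ ≤ τ, {t : ConeSpace S | t.1 (some τ) = 0} := by
    ext t
    simp only [face, Set.mem_ofPred_eq, Set.mem_inter_iff, Set.mem_iInter]
    exact and_congr_right fun _ => forall_congr' fun τ => not_imp_comm
  have hc : ∀ i, Continuous fun t : ConeSpace S => t.1 i :=
    fun i => (continuous_apply i).comp continuous_subtype_val
  rw [h]
  exact (isClosed_eq (hc _) continuous_const).inter
    (isClosed_iInter fun τ => isClosed_iInter fun _ => isClosed_eq (hc _) continuous_const)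

/-- The panel structure `{F_v}` on `Y^S`, indexed by the vertices. -/
def conePanels : PanelStructure (Vertex S) (ConeSpace S) where
  panel v := face v.toSimplex
  isClosed_panel _ := isClosed_face _
  locallyFinite_panel := locallyFinite_of_finite _

variable {S} in
theorem face_subset_inter {σ τ : Simplex S} (h : vertexSet τ.1 = vertexSet σ.1) :
    face τ ⊆ (conePanels S).inter (vertexSet σ.1) := by
  intro t ht
  simp only [PanelStructure.inter, Set.mem_iInter]
  intro v hv
  rw [← h] at hv
  refine ⟨ht.1, fun ω hω => ?_⟩
  have hv' : v.1 ≤ τ.1 := by simpa [vertexSet] using hv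
  exact hv'.trans (ht.2 ω hω)

variable {S} in
open Classical in
/-- A cohomology class of `P_{∩V(σ)}` is the component class of `σ` if it restricts to `1` on the
component `F_σ` and to `0` on every other component `F_τ`, `V(τ) = V(σ)`. -/
def IsComponentClass (σ : Simplex S)
    (a : CohomologyRing ((conePanels S).inter (vertexSet σ.1))) : Prop :=
  ∀ (τ : Simplex S) (h : vertexSet τ.1 = vertexSet σ.1),
    restrict (face_subset_inter h) a = if τ = σ then 1 else 0

open Classical in
/-- The defining relations of the face ring of `S`: `v_⊥ = 1`,
`v_σ v_τ = v_{σ ∧ τ} ∑ v_η` with `η` ranging over the minimal upper bounds of `σ` and `τ`, and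
`v_σ v_τ = 0` if `σ` and `τ` have no common upper bound (the meet need not exist then). -/
def faceRelations : Set (MvPolynomial S ℤ) :=
  {MvPolynomial.X ⊥ - 1} ∪
  {p | ∃ σ τ μ : S, IsGLB {σ, τ} μ ∧ p = MvPolynomial.X σ * MvPolynomial.X τ -
    MvPolynomial.X μ *
      ∑ η ∈ Finset.univ.filter (fun η => Minimal (· ∈ upperBounds {σ, τ}) η), MvPolynomial.X η} ∪
  {p | ∃ σ τ : S, ¬ BddAbove {σ, τ} ∧ p = MvPolynomial.X σ * MvPolynomial.X τ}

/-- Stanley's face ring `ℤ[S]`. -/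
abbrev StanleyFaceRing : Type _ := MvPolynomial S ℤ ⧸ Ideal.span (faceRelations S)

variable {S} in
/-- The generator `v_σ` of the face ring. -/
def StanleyFaceRing.v (σ : S) : StanleyFaceRing S := Ideal.Quotient.mk _ (MvPolynomial.X σ)

end SimplicialPoset

end FaceSpace

end

/-!
Both rings embed into the product of polynomial rings `∏_{ω ∈ S} ℤ[x_v]`, with the same image; the
isomorphism is the identification of the two images.

The cone `Y^S` is the realization of the order complex of `S`, its apex being the vertex `⊥`. For
`σ ∈ S` the subspace `dualFace σ` spanned by the vertices `≥ σ` is star-shaped around the vertex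
`σ`, and `P_{∩J}` is the disjoint union of the closed sets `dualFace σ` with `vertexSet σ = J`.
Coning singular simplices along the linear contraction shows that the cohomology of `dualFace σ`
is `ℤ` (`CohomologyRing.exists_eq_zsmul_one`), and cochains glue along a finite disjoint closed
cover (`CohomologyRing.eq_zero_of_restrict_eq_zero`). Hence `H^*(P_{∩J})` is generated by the
classes `e_σ` of the components, and the elements `e_σ ⊗ x^a`, with the support of `a` equal to
the vertex set of `σ`, generate the topological face ring. Evaluation of cohomology classes at
the vertex `ω` of the cone is a ring homomorphism to `ℤ[x_v]` that sends `e_σ ⊗ x^a` to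
`[σ ≤ ω] x^a`. The coefficients of `x^a` in the component `σ` are a dual family, so the
evaluations are jointly injective (`TopologicalFaceRing.restriction_injective`).

On the side of Stanley's face ring, `v_σ ↦ [σ ≤ ω] ∏_{v ≤ σ} x_v` respects the relations, because
in the Boolean lattice `[⊥, ω]` the meet and the join correspond to the intersection and the union
of vertex sets. The straightening relations show that chain monomials generate the ring
(`faceMonomial_mem_closure`). A chain of faces of `ω` can be recovered from its exponent vector
(`eq_of_totalExponent_eq`), so the images of the chain monomials again have a dual family, and the
restriction is injective (`StanleyFaceRing.restriction_injective`). Each `([σ ≤ ω] x^a)_ω` is the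
image of a chain monomial (`exists_restriction_eq_monomial`), so that the images coincide
(`range_restriction_eq`).
-/

noncomputable section

namespace FaceSpace

/-! ### Cohomology of contractible spaces -/

theorem CohomologyRing.one_eq_of (X : Type*) [TopologicalSpace X] :
    (1 : CohomologyRing X) = CohomologyRing.of X 0 (QuotientAddGroup.mk (oneCocycle X)) := rfl

theorem CohomologyRing.induction_on {X : Type*} [TopologicalSpace X]
    {p : CohomologyRing X → Prop} (a : CohomologyRing X) (zero : p 0)
    (of : ∀ n (f : cocycles X n), p (CohomologyRing.of X n (QuotientAddGroup.mk f)))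
    (add : ∀ a b, p a → p b → p (a + b)) : p a := by
  refine DirectSum.induction_on (β := Cohomology X) (motive := p) a zero (fun n a => ?_) add
  induction a using QuotientAddGroup.induction_on with | H f => exact of n f

section Contraction

/-- The join coordinates `(u, r) ↦ (r, (1 - r) u)` of the simplex `Δⁿ⁺¹`, regarded as the cone
with apex the vertex `0` over the opposite face. -/
def joinMap (n : ℕ) (p : stdSimplex ℝ (Fin (n + 1)) × unitInterval) : stdSimplex ℝ (Fin (n + 2)) :=
  ⟨Fin.cons (p.2 : ℝ) fun i => (1 - (p.2 : ℝ)) * p.1.1 i, by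
    refine ⟨fun i => ?_, ?_⟩
    · refine Fin.cases ?_ (fun j => ?_) i
      · exact p.2.2.1
      · exact mul_nonneg (sub_nonneg.2 p.2.2.2) (p.1.2.1 j)
    · rw [Fin.sum_univ_succ]
      simp only [Fin.cons_zero, Fin.cons_succ]
      rw [← Finset.mul_sum, p.1.2.2]
      ring⟩

theorem joinMap_zero {n : ℕ} (p : stdSimplex ℝ (Fin (n + 1)) × unitInterval) :
    joinMap n p 0 = (p.2 : ℝ) := rfl

theorem joinMap_succ {n : ℕ} (p : stdSimplex ℝ (Fin (n + 1)) × unitInterval) (i : Fin (n + 1)) :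
    joinMap n p i.succ = (1 - (p.2 : ℝ)) * p.1 i := rfl

theorem continuous_joinMap (n : ℕ) : Continuous (joinMap n) := by
  refine Continuous.subtype_mk (continuous_pi fun i => ?_) _
  refine Fin.cases ?_ (fun j => ?_) i
  · exact continuous_subtype_val.comp continuous_snd
  · have h : Continuous fun p : stdSimplex ℝ (Fin (n + 1)) × unitInterval => p.1.1 j :=
      (continuous_apply j).comp (continuous_subtype_val.comp continuous_fst)
    exact (continuous_const.sub (continuous_subtype_val.comp continuous_snd)).mul h

/-- At the apex, where the coordinate `0` is `1`, the base point is arbitrary. -/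
theorem surjective_joinMap (n : ℕ) : Function.Surjective (joinMap n) := by
  intro w
  have hsum : w 0 + ∑ i : Fin (n + 1), w i.succ = 1 := by
    rw [← Fin.sum_univ_succ]; exact w.2.2
  let r : unitInterval := ⟨w 0, stdSimplex.zero_le w 0, stdSimplex.le_one w 0⟩
  by_cases h : w 0 = 1
  · refine ⟨(stdSimplex.vertex 0, r), stdSimplex.ext (funext fun i => ?_)⟩
    have h0 : ∀ i : Fin (n + 1), w i.succ = 0 := fun i =>
      (Finset.sum_eq_zero_iff_of_nonneg fun i _ => stdSimplex.zero_le w _).1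
        (by linarith) i (Finset.mem_univ i)
    refine Fin.cases rfl (fun j => ?_) i
    rw [joinMap_succ, h0]
    simp [r, h]
  · have h1 : 1 - w 0 ≠ 0 := sub_ne_zero.2 (Ne.symm h)
    refine ⟨(⟨fun i => w i.succ / (1 - w 0), fun i => ?_, ?_⟩, r),
      stdSimplex.ext (funext fun i => ?_)⟩
    · exact div_nonneg (stdSimplex.zero_le w _) (sub_nonneg.2 (stdSimplex.le_one w 0))
    · rw [← Finset.sum_div, div_eq_one_iff_eq h1]
      linarith
    · refine Fin.cases rfl (fun j => ?_) i
      rw [joinMap_succ]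
      exact mul_div_cancel₀ _ h1

theorem isQuotientMap_joinMap (n : ℕ) : Topology.IsQuotientMap (joinMap n) :=
  (continuous_joinMap n).isClosedMap.isQuotientMap (continuous_joinMap n) (surjective_joinMap n)

theorem eq_of_joinMap_eq {n : ℕ} {p p' : stdSimplex ℝ (Fin (n + 1)) × unitInterval}
    (h : joinMap n p = joinMap n p') : p = p' ∨ p.2 = 1 ∧ p'.2 = 1 := by
  have h0 : p.2 = p'.2 := Subtype.ext (DFunLike.congr_fun h 0)
  by_cases h1 : p.2 = 1
  · exact Or.inr ⟨h1, h0 ▸ h1⟩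
  · refine Or.inl (Prod.ext (stdSimplex.ext (funext fun i => ?_)) h0)
    have hs := DFunLike.congr_fun h i.succ
    rw [joinMap_succ, joinMap_succ, ← h0] at hs
    exact mul_left_cancel₀ (sub_ne_zero.2 fun e => h1 (Subtype.ext e.symm)) hs

variable {X : Type*} [TopologicalSpace X] {H : C(X × unitInterval, X)} {x₀ : X}

theorem factorsThrough_joinMap (h1 : ∀ x, H (x, 1) = x₀) {n : ℕ} (s : SingularSimplex X n) :
    Function.FactorsThrough (H.comp (s.prodMap (ContinuousMap.id unitInterval)))
      (⟨joinMap n, continuous_joinMap n⟩ : C(_, _)) := by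
  intro p p' hp
  rcases eq_of_joinMap_eq hp with rfl | ⟨h, h'⟩
  · rfl
  · change H (s p.1, p.2) = H (s p'.1, p'.2)
    rw [h, h', h1, h1]

/-- The cone over a singular simplex, formed along a contraction `H` of `X` to `x₀`: in join
coordinates it is `(u, r) ↦ H (s u, r)`. -/
def coneSimplex (h1 : ∀ x, H (x, 1) = x₀) {n : ℕ} (s : SingularSimplex X n) :
    SingularSimplex X (n + 1) :=
  (isQuotientMap_joinMap n).lift _ (factorsThrough_joinMap h1 s)

theorem coneSimplex_joinMap (h1 : ∀ x, H (x, 1) = x₀) {n : ℕ} (s : SingularSimplex X n)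
    (p : stdSimplex ℝ (Fin (n + 1)) × unitInterval) :
    coneSimplex h1 s (joinMap n p) = H (s p.1, p.2) :=
  DFunLike.congr_fun (Topology.IsQuotientMap.lift_comp (isQuotientMap_joinMap n) _
    (factorsThrough_joinMap h1 s)) p

theorem map_succ_eq_joinMap {n : ℕ} (u : stdSimplex ℝ (Fin (n + 1))) :
    stdSimplex.map Fin.succ u = joinMap n (u, 0) := by
  ext i
  rw [stdSimplex.map_coe, FunOnFinite.linearMap_apply_apply, Finset.sum_filter]
  refine Fin.cases ?_ (fun j => ?_) i
  · simp [joinMap_zero, Fin.succ_ne_zero]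
  · simp [joinMap_succ]

theorem map_succ_succAbove_joinMap {n : ℕ} (i : Fin (n + 2))
    (p : stdSimplex ℝ (Fin (n + 1)) × unitInterval) :
    stdSimplex.map i.succ.succAbove (joinMap n p) =
      joinMap (n + 1) (stdSimplex.map i.succAbove p.1, p.2) := by
  ext k
  rw [stdSimplex.map_coe, FunOnFinite.linearMap_apply_apply, Finset.sum_filter, Fin.sum_univ_succ]
  refine Fin.cases ?_ (fun j => ?_) k
  · simp [joinMap_zero, Fin.succ_ne_zero]
  · simp only [joinMap_succ, Fin.succ_succAbove_zero, Fin.succ_succAbove_succ,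
      (Fin.succ_ne_zero j).symm, if_false, zero_add, Fin.succ_inj]
    rw [stdSimplex.map_coe, FunOnFinite.linearMap_apply_apply, Finset.sum_filter, Finset.mul_sum]
    simp only [mul_ite, mul_zero]

theorem map_one_succAbove_eq_joinMap (u : stdSimplex ℝ (Fin 1)) :
    stdSimplex.map (Fin.succAbove (1 : Fin 2)) u = joinMap 0 (u, 1) := by
  ext k
  rw [stdSimplex.map_coe, FunOnFinite.linearMap_apply_apply, Finset.sum_filter]
  refine Fin.cases ?_ (fun j => ?_) k
  · rw [Fin.sum_univ_one]
    exact (if_pos rfl).trans (stdSimplex.eq_one_of_unique u 0)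
  · simp [joinMap_succ, (Fin.succ_ne_zero j).symm]

theorem pull_zero_coneSimplex (h0 : ∀ x, H (x, 0) = x) (h1 : ∀ x, H (x, 1) = x₀) {n : ℕ}
    (s : SingularSimplex X n) :
    SingularSimplex.pull (Fin.succAbove (0 : Fin (n + 2))) (coneSimplex h1 s) = s := by
  ext u
  change coneSimplex h1 s (stdSimplex.map (Fin.succAbove 0) u) = s u
  rw [Fin.succAbove_zero, map_succ_eq_joinMap, coneSimplex_joinMap, h0]

theorem pull_succ_coneSimplex (h1 : ∀ x, H (x, 1) = x₀) {n : ℕ} (i : Fin (n + 2))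
    (s : SingularSimplex X (n + 1)) :
    SingularSimplex.pull i.succ.succAbove (coneSimplex h1 s) =
      coneSimplex h1 (SingularSimplex.pull i.succAbove s) := by
  ext w
  obtain ⟨p, rfl⟩ := surjective_joinMap n w
  rw [coneSimplex_joinMap]
  change coneSimplex h1 s (stdSimplex.map i.succ.succAbove (joinMap n p)) = _
  rw [map_succ_succAbove_joinMap, coneSimplex_joinMap]
  rfl

theorem pull_one_coneSimplex (h1 : ∀ x, H (x, 1) = x₀) (s : SingularSimplex X 0) :
    SingularSimplex.pull (Fin.succAbove (1 : Fin 2)) (coneSimplex h1 s) =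
      ContinuousMap.const _ x₀ := by
  ext u
  change coneSimplex h1 s (stdSimplex.map (Fin.succAbove 1) u) = x₀
  rw [map_one_succAbove_eq_joinMap, coneSimplex_joinMap, h1]

theorem cocycle_zero_eq_const (h0 : ∀ x, H (x, 0) = x) (h1 : ∀ x, H (x, 1) = x₀)
    {f : Cochain X 0} (hf : f ∈ cocycles X 0) (s : SingularSimplex X 0) :
    f s = f (ContinuousMap.const _ x₀) := by
  have h := congrFun (mem_cocycles.1 hf) (coneSimplex h1 s)
  rw [coboundary_apply, Fin.sum_univ_two, pull_zero_coneSimplex h0, pull_one_coneSimplex] at h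
  simp at h
  linarith

/-- Precomposition with the cone operator is a contracting homotopy in positive degrees. -/
theorem cocycles_succ_le_coboundaries (h0 : ∀ x, H (x, 0) = x) (h1 : ∀ x, H (x, 1) = x₀)
    {n : ℕ} {f : Cochain X (n + 1)} (hf : f ∈ cocycles X (n + 1)) :
    f ∈ coboundaries X (n + 1) := by
  refine ⟨fun s => f (coneSimplex h1 s), funext fun s => ?_⟩
  have h := congrFun (mem_cocycles.1 hf) (coneSimplex h1 s)
  rw [coboundary_apply, Fin.sum_univ_succ, pull_zero_coneSimplex h0] at h
  simp only [pull_succ_coneSimplex, Fin.val_zero, pow_zero, one_mul, Fin.val_succ, pow_succ,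
    mul_neg, mul_one, neg_mul, Finset.sum_neg_distrib, Pi.zero_apply] at h
  rw [coboundary_apply]
  linarith

/-- The cohomology ring of a contractible space consists of the integer multiples of `1`. -/
theorem CohomologyRing.exists_eq_zsmul_one (h0 : ∀ x, H (x, 0) = x) (h1 : ∀ x, H (x, 1) = x₀)
    (a : CohomologyRing X) : ∃ k : ℤ, a = k • 1 := by
  induction a using CohomologyRing.induction_on with
  | zero => exact ⟨0, (zero_zsmul _).symm⟩
  | add a b ha hb =>
    obtain ⟨k, rfl⟩ := ha
    obtain ⟨l, rfl⟩ := hb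
    exact ⟨k + l, (add_zsmul _ k l).symm⟩
  | of n f =>
    cases n with
    | zero =>
      refine ⟨f.1 (ContinuousMap.const _ x₀), ?_⟩
      have hf : f = f.1 (ContinuousMap.const _ x₀) • oneCocycle X := by
        ext s
        change f.1 s = _ * 1
        rw [mul_one]
        exact cocycle_zero_eq_const h0 h1 f.2 s
      rw [CohomologyRing.one_eq_of, ← map_zsmul]
      exact congrArg (fun g => CohomologyRing.of X 0 (QuotientAddGroup.mk g)) hf
    | succ n =>
      have hf : (QuotientAddGroup.mk f : Cohomology X (n + 1)) = 0 :=
        (QuotientAddGroup.eq_zero_iff _).2 (cocycles_succ_le_coboundaries h0 h1 f.2)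
      exact ⟨0, by rw [hf, map_zero, zero_zsmul]⟩

end Contraction

/-! ### Finite disjoint closed covers and components -/

section Components

variable {X Y : Type*} [TopologicalSpace X] [TopologicalSpace Y]

/-- A singular simplex lies in a single member of a finite disjoint closed cover. -/
theorem SingularSimplex.exists_lift {ι : Type*} [Finite ι] {A : ι → Set Y} {B : Set Y}
    (hA : ∀ i, A i ⊆ B) (hB : B ⊆ ⋃ i, A i) (hd : ∀ i j y, y ∈ A i → y ∈ A j → i = j)
    (hc : ∀ i, IsClosed (A i)) {n : ℕ} (s : SingularSimplex B n) :
    ∃ (i : ι) (t : SingularSimplex (A i) n),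
      ContinuousMap.comp ⟨Set.inclusion (hA i), continuous_inclusion (hA i)⟩ t = s := by
  let u₀ : stdSimplex ℝ (Fin (n + 1)) := stdSimplex.vertex 0
  obtain ⟨i, hi⟩ := Set.mem_iUnion.1 (hB (s u₀).2)
  have hcont : Continuous fun u => (s u).1 := continuous_subtype_val.comp s.continuous
  have hcl : ∀ j, IsClosed ((fun u => (s u).1) ⁻¹' A j) := fun j => (hc j).preimage hcont
  have hcompl : ((fun u => (s u).1) ⁻¹' A i)ᶜ = ⋃ j : {j // j ≠ i}, (fun u => (s u).1) ⁻¹' A j := by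
    ext u
    simp only [Set.mem_compl_iff, Set.mem_preimage, Set.mem_iUnion]
    constructor
    · intro h
      obtain ⟨j, hj⟩ := Set.mem_iUnion.1 (hB (s u).2)
      exact ⟨⟨j, fun e => h (e ▸ hj)⟩, hj⟩
    · rintro ⟨⟨j, hne⟩, hj⟩ h
      exact hne (hd _ _ _ hj h)
  have hclopen : IsClopen ((fun u => (s u).1) ⁻¹' A i) :=
    ⟨hcl i, isClosed_compl_iff.1 (hcompl ▸ isClosed_iUnion_of_finite fun j => hcl _)⟩
  have huniv := hclopen.eq_univ ⟨u₀, hi⟩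
  have hmem : ∀ u, (s u).1 ∈ A i := fun u => by
    have : u ∈ (fun u => (s u).1) ⁻¹' A i := huniv ▸ Set.mem_univ u
    exact this
  exact ⟨i, ⟨fun u => ⟨(s u).1, hmem u⟩, hcont.subtype_mk _⟩, rfl⟩

/-- The homogeneous component of degree `n` of a class in the cohomology ring. -/
def CohomologyRing.component (X : Type*) [TopologicalSpace X] (n : ℕ) :
    CohomologyRing X →+ Cohomology X n :=
  DFinsupp.evalAddMonoidHom n

theorem CohomologyRing.component_of_same (n : ℕ) (a : Cohomology X n) :
    CohomologyRing.component X n (CohomologyRing.of X n a) = a :=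
  DirectSum.of_eq_same _ _

theorem CohomologyRing.component_of_ne {m n : ℕ} (h : n ≠ m) (a : Cohomology X m) :
    CohomologyRing.component X n (CohomologyRing.of X m a) = 0 :=
  DirectSum.of_eq_of_ne _ _ _ h

theorem CohomologyRing.component_map (g : C(X, Y)) (a : CohomologyRing Y) (n : ℕ) :
    CohomologyRing.component X n (CohomologyRing.map g a) =
      cohomologyMap g n (CohomologyRing.component Y n a) := by
  induction a using CohomologyRing.induction_on with
  | zero => simp only [map_zero]
  | add a b ha hb => simp only [map_add, ha, hb]
  | of m f =>
    rw [CohomologyRing.map_of]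
    by_cases h : n = m
    · subst h
      rw [CohomologyRing.component_of_same, CohomologyRing.component_of_same]
    · rw [CohomologyRing.component_of_ne h, CohomologyRing.component_of_ne h, map_zero]

/-- A cohomology class vanishes if it vanishes on each member of a finite disjoint closed cover:
the cochains that bound the restrictions glue, since every singular simplex lies in exactly one
member. -/
theorem CohomologyRing.eq_zero_of_restrict_eq_zero {ι : Type*} [Finite ι] {A : ι → Set Y}
    {B : Set Y} (hA : ∀ i, A i ⊆ B) (hB : B ⊆ ⋃ i, A i)
    (hd : ∀ i j y, y ∈ A i → y ∈ A j → i = j) (hc : ∀ i, IsClosed (A i))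
    (a : CohomologyRing B) (ha : ∀ i, restrict (hA i) a = 0) : a = 0 := by
  refine DFinsupp.ext fun n => (?_ : CohomologyRing.component B n a = 0)
  have ha' : ∀ i, cohomologyMap ⟨Set.inclusion (hA i), continuous_inclusion (hA i)⟩ n
      (CohomologyRing.component B n a) = 0 := fun i => by
    rw [← CohomologyRing.component_map, ← restrict, ha, map_zero]
  revert ha'
  induction CohomologyRing.component B n a using QuotientAddGroup.induction_on with | H f => ?_
  intro ha'
  refine (QuotientAddGroup.eq_zero_iff _).2 ?_
  have hf : ∀ i, cochainMap ⟨Set.inclusion (hA i), continuous_inclusion (hA i)⟩ n f.1 ∈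
      coboundaries (A i) n := fun i =>
    (QuotientAddGroup.eq_zero_iff (cocycleMap _ n f)).1 (ha' i)
  change f.1 ∈ coboundaries B n
  cases n with
  | zero =>
    change f.1 = 0
    funext s
    obtain ⟨i, t, rfl⟩ := SingularSimplex.exists_lift hA hB hd hc s
    have h : cochainMap ⟨Set.inclusion (hA i), continuous_inclusion (hA i)⟩ 0 f.1 = 0 := hf i
    exact congrFun h t
  | succ n =>
    choose b hb using hf
    choose idx lift hlift using SingularSimplex.exists_lift hA hB hd hc (n := n)
    -- The glued cochain does not depend on the chosen member and lift.
    have key : ∀ (i j : ι) (t : SingularSimplex (A i) n) (t' : SingularSimplex (A j) n),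
        ContinuousMap.comp ⟨Set.inclusion (hA i), continuous_inclusion (hA i)⟩ t =
          ContinuousMap.comp ⟨Set.inclusion (hA j), continuous_inclusion (hA j)⟩ t' →
        b i t = b j t' := by
      intro i j t t' h
      have hv : ∀ u, (t u).1 = (t' u).1 := fun u => congrArg Subtype.val (DFunLike.congr_fun h u)
      obtain rfl : i = j := hd i j _ (t (stdSimplex.vertex 0)).2
        (hv (stdSimplex.vertex 0) ▸ (t' (stdSimplex.vertex 0)).2)
      congr 1
      ext u
      exact hv u
    refine ⟨fun s => b (idx s) (lift s), funext fun s => ?_⟩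
    obtain ⟨i, t, rfl⟩ := SingularSimplex.exists_lift hA hB hd hc s
    refine Eq.trans ?_ (congrFun (hb i) t)
    rw [coboundary_apply, coboundary_apply]
    refine Finset.sum_congr rfl fun k _ => ?_
    congr 1
    exact key _ _ _ _ ((hlift _).trans (SingularSimplex.pull_comp _ _ _))

/-- The class in `H⁰(X)` of the characteristic function of a clopen set. -/
def clopenClass (U : Set X) (hU : IsClopen U) : CohomologyRing X :=
  CohomologyRing.of X 0 (QuotientAddGroup.mk
    ⟨fun s => U.indicator 1 (s default), by
      rw [mem_cocycles]
      ext s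
      have h : ∀ u v, U.indicator (1 : X → ℤ) (s u) = U.indicator (1 : X → ℤ) (s v) := by
        have hp := hU.preimage s.continuous
        intro u v
        by_cases hv : s v ∈ U
        · have hu : s u ∈ U := show u ∈ s ⁻¹' U from hp.eq_univ ⟨v, hv⟩ ▸ Set.mem_univ u
          rw [Set.indicator_of_mem hv, Set.indicator_of_mem hu]; rfl
        · have hu : s u ∉ U := fun hu => hv (show v ∈ s ⁻¹' U from
            hp.eq_univ ⟨u, hu⟩ ▸ Set.mem_univ v)
          rw [Set.indicator_of_notMem hv, Set.indicator_of_notMem hu]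
      rw [coboundary_apply, Fin.sum_univ_two]
      simp only [SingularSimplex.pull, ContinuousMap.comp_apply, ContinuousMap.coe_mk]
      rw [h _ (stdSimplex.map (Fin.succAbove (1 : Fin 2)) default)]
      simp⟩)

theorem map_clopenClass_eq_one {U : Set Y} {hU : IsClopen U} {g : C(X, Y)} (h : ∀ x, g x ∈ U) :
    CohomologyRing.map g (clopenClass U hU) = 1 := by
  rw [clopenClass, CohomologyRing.map_of, CohomologyRing.one_eq_of]
  refine congrArg (fun f => CohomologyRing.of X 0 (QuotientAddGroup.mk f)) (Subtype.ext ?_)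
  funext s
  exact Set.indicator_of_mem (h _) _

theorem map_clopenClass_eq_zero {U : Set Y} {hU : IsClopen U} {g : C(X, Y)} (h : ∀ x, g x ∉ U) :
    CohomologyRing.map g (clopenClass U hU) = 0 := by
  rw [clopenClass, CohomologyRing.map_of]
  refine Eq.trans ?_ (map_zero (CohomologyRing.of X 0))
  refine congrArg (fun f => CohomologyRing.of X 0 (QuotientAddGroup.mk f))
    (Subtype.ext ?_ : _ = (0 : cocycles X 0))
  funext s
  exact Set.indicator_of_notMem (h _) _

end Components

/-! ### Evaluation at a point -/

section PointEvaluation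

variable {X Y : Type*} [TopologicalSpace X] [TopologicalSpace Y]

/-- Evaluation of a cohomology class of degree `n` at a point; it vanishes for `n ≠ 0`. -/
def cohomologyEval (x : X) (n : ℕ) : Cohomology X n →+ ℤ :=
  QuotientAddGroup.lift _
    (AddMonoidHom.mk' (fun f : cocycles X n => if n = 0 then f.1 (ContinuousMap.const _ x) else 0)
      (fun f g => by split_ifs <;> simp))
    (fun f hf => by
      cases n with
      | zero =>
        have h : f.1 = 0 := hf
        change (if 0 = 0 then f.1 (ContinuousMap.const _ x) else 0) = 0
        rw [h]; simp
      | succ n =>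
        exact if_neg (c := n + 1 = 0) (t := f.1 (ContinuousMap.const _ x)) (Nat.succ_ne_zero n))

/-- Evaluation at a point as a ring homomorphism `H^*(X) → H^*(pt) = ℤ`. -/
def pointEval (x : X) : CohomologyRing X →+* ℤ :=
  DirectSum.toSemiring (cohomologyEval x) rfl (by
    intro p q a b
    induction a using QuotientAddGroup.induction_on with | H a => ?_
    induction b using QuotientAddGroup.induction_on with | H b => ?_
    change (if p + q = 0 then a.1 (ContinuousMap.const _ x) * b.1 (ContinuousMap.const _ x) else 0)
      = (if p = 0 then a.1 (ContinuousMap.const _ x) else 0) *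
        (if q = 0 then b.1 (ContinuousMap.const _ x) else 0)
    by_cases hp : p = 0 <;> by_cases hq : q = 0 <;> simp [hp, hq])

theorem pointEval_of (x : X) (n : ℕ) (f : cocycles X n) :
    pointEval x (CohomologyRing.of X n (QuotientAddGroup.mk f)) =
      if n = 0 then f.1 (ContinuousMap.const _ x) else 0 :=
  DirectSum.toSemiring_of _ _ _ _ _

theorem pointEval_map (g : C(X, Y)) (x : X) (a : CohomologyRing Y) :
    pointEval x (CohomologyRing.map g a) = pointEval (g x) a := by
  have h : (pointEval x).comp (CohomologyRing.map g) = pointEval (g x) := by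
    refine CohomologyRing.ringHom_ext fun n f => ?_
    rw [RingHom.comp_apply, CohomologyRing.map_of, pointEval_of]
    exact pointEval_of x n (cocycleMap g n f)
  exact RingHom.congr_fun h a

theorem pointEval_clopenClass (x : X) {U : Set X} (hU : IsClopen U) :
    pointEval x (clopenClass U hU) = U.indicator 1 x := pointEval_of x 0 _

open Classical in
/-- Evaluation of the classes of a subspace `A` at a point `y` of the ambient space, extended by
zero to the points outside `A`. -/
def subspaceEval (A : Set Y) (y : Y) : CohomologyRing A →ₗ[ℤ] ℤ :=
  if h : y ∈ A then (pointEval (⟨y, h⟩ : A)).toAddMonoidHom.toIntLinearMap else 0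

theorem subspaceEval_of_mem {A : Set Y} {y : Y} (h : y ∈ A) (a : CohomologyRing A) :
    subspaceEval A y a = pointEval (⟨y, h⟩ : A) a := by
  rw [subspaceEval, dif_pos h]; rfl

theorem subspaceEval_of_notMem {A : Set Y} {y : Y} (h : y ∉ A) (a : CohomologyRing A) :
    subspaceEval A y a = 0 := by
  rw [subspaceEval, dif_neg h]; rfl

variable {ι : Type*} (P : PanelStructure ι Y)

theorem PanelStructure.mem_inter_add {I J : IndexSet ι} {y : Y} :
    y ∈ P.inter (I + J).toFinset ↔ y ∈ P.inter I.toFinset ∧ y ∈ P.inter J.toFinset := by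
  refine ⟨fun h => ⟨P.inter_anti (IndexSet.subset_add_left I J) h,
    P.inter_anti (IndexSet.subset_add_right I J) h⟩, fun ⟨hI, hJ⟩ => ?_⟩
  classical
  simp only [PanelStructure.inter, Set.mem_iInter] at *
  intro j hj
  exact (Finset.mem_union.1 hj).elim (hI j) (hJ j)

/-- The component at `J` of the evaluation of the topological face ring at `y`. -/
def summandEval (y : Y) (J : IndexSet ι) : FaceSummand P J →ₗ[ℤ] MvPolynomial ι ℤ :=
  TensorProduct.lift ((LinearMap.lsmul ℤ (MvPolynomial ι ℤ)).compl₁₂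
    (subspaceEval (P.inter J.toFinset) y) (exactMonomials J.toFinset).subtype)

theorem summandEval_tmul (y : Y) (J : IndexSet ι) (a : CohomologyRing (P.inter J.toFinset))
    (f : exactMonomials J.toFinset) :
    summandEval P y J (a ⊗ₜ f) = subspaceEval (P.inter J.toFinset) y a • f.1 := rfl

theorem summandEval_mul (y : Y) {I J : IndexSet ι} (a : FaceSummand P I) (b : FaceSummand P J) :
    summandEval P y (I + J) (starMul P I J a b) = summandEval P y I a * summandEval P y J b := by
  induction a using TensorProduct.induction_on with
  | zero => simp
  | add a a' ha ha' => rw [LinearMap.map_add₂, map_add, ha, ha', map_add, add_mul]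
  | tmul a f =>
  induction b using TensorProduct.induction_on with
  | zero => simp
  | add b b' hb hb' => rw [map_add, map_add, hb, hb', map_add, mul_add]
  | tmul b g =>
    rw [starMul_tmul, summandEval_tmul, summandEval_tmul, summandEval_tmul, smul_mul_smul_comm]
    congr 1
    by_cases h : y ∈ P.inter (I + J).toFinset
    · obtain ⟨hI, hJ⟩ := P.mem_inter_add.1 h
      rw [subspaceEval_of_mem h, subspaceEval_of_mem hI, subspaceEval_of_mem hJ, map_mul,
        restrict, restrict, pointEval_map, pointEval_map]
      rfl
    · rw [subspaceEval_of_notMem h]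
      rw [P.mem_inter_add, not_and_or] at h
      rcases h with h | h <;> simp [subspaceEval_of_notMem h]

theorem summandEval_one (y : Y) : summandEval P y 0 (starOne P) = 1 := by
  have h : y ∈ P.inter (0 : IndexSet ι).toFinset := by
    have h0 : (0 : IndexSet ι).toFinset = (∅ : Finset ι) := rfl
    simp [PanelStructure.inter, h0]
  rw [starOne, summandEval_tmul, subspaceEval_of_mem h, map_one, one_smul]

/-- The identity map between the topological face ring and the direct sum that defines it. -/
def TopologicalFaceRing.toDirectSum :
    TopologicalFaceRing P ≃+* ⨁ J : IndexSet ι, FaceSummand P J where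
  toFun x := x
  invFun x := x
  left_inv _ := rfl
  right_inv _ := rfl
  map_mul' _ _ := rfl
  map_add' _ _ := rfl

/-- Evaluation of the topological face ring at a point, on the underlying direct sum. -/
def directSumEval (y : Y) : (⨁ J : IndexSet ι, FaceSummand P J) →+* MvPolynomial ι ℤ := by
  refine DirectSum.toSemiring (fun J => (summandEval P y J).toAddMonoidHom) ?_ ?_
  · exact summandEval_one P y
  · intro I J a b
    exact summandEval_mul P y a b

theorem directSumEval_of (y : Y) (J : IndexSet ι) (a : FaceSummand P J) :
    directSumEval P y (DirectSum.of (FaceSummand P) J a) = summandEval P y J a :=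
  DirectSum.toAddMonoid_of (fun J => (summandEval P y J).toAddMonoidHom) J a

/-- Evaluation of the topological face ring at a point `y`: it sends `φ ⊗ f` with
`φ ∈ H^*(P_{∩J})` to `φ(y) f` if `y ∈ P_{∩J}` and to `0` otherwise. -/
def TopologicalFaceRing.eval (y : Y) : TopologicalFaceRing P →+* MvPolynomial ι ℤ :=
  (directSumEval P y).comp (TopologicalFaceRing.toDirectSum P : TopologicalFaceRing P →+* _)

theorem TopologicalFaceRing.eval_of (y : Y) (J : Finset ι)
    (a : CohomologyRing (P.inter J) ⊗[ℤ] exactMonomials J) :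
    TopologicalFaceRing.eval P y (TopologicalFaceRing.of P J a) = summandEval P y J a :=
  directSumEval_of P y J a

theorem TopologicalFaceRing.induction_on {p : TopologicalFaceRing P → Prop}
    (x : TopologicalFaceRing P) (zero : p 0)
    (of : ∀ (J : Finset ι) (a : CohomologyRing (P.inter J)) (f : exactMonomials J),
      p (TopologicalFaceRing.of P J (a ⊗ₜ f)))
    (add : ∀ x y, p x → p y → p (x + y)) : p x := by
  refine DirectSum.induction_on (β := FaceSummand P) (motive := p) x zero (fun J a => ?_) add
  change p (TopologicalFaceRing.of P J a)
  induction a using TensorProduct.induction_on with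
  | zero => rwa [map_zero]
  | tmul a f => exact of J a f
  | add a b ha hb => rw [map_add]; exact add _ _ ha hb

end PointEvaluation

/-! ### Faces of a simplicial poset -/

section Faces

/-- A singleton in the Boolean model of a segment corresponds to a vertex. -/
theorem exists_vertex_of_segment {S : Type*} [PartialOrder S] [OrderBot S] {ω : S} {n : ℕ}
    (e : Set.Icc ⊥ ω ≃o Finset (Fin n)) (i : Fin n) :
    ∃ (v : Vertex S) (hv : v.1 ∈ Set.Icc ⊥ ω), e ⟨v.1, hv⟩ = {i} := by
  have hbot : e ⟨⊥, le_rfl, bot_le⟩ = ∅ := by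
    have h : (⟨⊥, le_rfl, bot_le⟩ : Set.Icc ⊥ ω) ≤ e.symm ∅ := bot_le (α := S)
    exact Finset.subset_empty.1 ((OrderIso.le_symm_apply e).1 h)
  refine ⟨⟨(e.symm {i}).1, fun h => ?_, fun b hb => ?_⟩, (e.symm {i}).2, e.apply_symm_apply _⟩
  · have h' : e.symm {i} = ⟨⊥, le_rfl, bot_le⟩ := Subtype.ext h
    have h2 := congrArg e h'
    rw [hbot, e.apply_symm_apply] at h2
    exact Finset.singleton_ne_empty i h2
  · have hlt : (⟨b, bot_le, hb.le.trans (e.symm {i}).2.2⟩ : Set.Icc ⊥ ω) < e.symm {i} := hb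
    have h2 := e.lt_iff_lt.2 hlt
    rw [e.apply_symm_apply] at h2
    have h3 := (Finset.ssubset_singleton_iff.1 h2).trans hbot.symm
    exact congrArg Subtype.val (e.injective h3)

variable {S : Type*} [PartialOrder S] [OrderBot S] [Fintype S]

theorem mem_vertexSet {v : Vertex S} {σ : S} : v ∈ vertexSet σ ↔ v.1 ≤ σ := by
  simp [vertexSet]

theorem vertexSet_mono {σ τ : S} (h : σ ≤ τ) : vertexSet σ ⊆ vertexSet τ := fun _ hv =>
  mem_vertexSet.2 ((mem_vertexSet.1 hv).trans h)

theorem vertexSet_bot : vertexSet (⊥ : S) = ∅ :=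
  Finset.eq_empty_of_forall_notMem fun v hv => v.2.1 (le_bot_iff.1 (mem_vertexSet.1 hv))

namespace IsSimplicialPoset

variable (hS : IsSimplicialPoset S)
include hS

/-- Within a segment, faces are ordered by inclusion of their vertex sets. -/
theorem le_of_vertexSet_subset {σ τ ω : S} (hσ : σ ≤ ω) (hτ : τ ≤ ω)
    (h : vertexSet σ ⊆ vertexSet τ) : σ ≤ τ := by
  obtain ⟨n, ⟨e⟩⟩ := hS ω
  have key : e ⟨σ, bot_le, hσ⟩ ≤ e ⟨τ, bot_le, hτ⟩ := by
    intro i hi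
    obtain ⟨v, hv, he⟩ := exists_vertex_of_segment e i
    have hvσ : (⟨v.1, hv⟩ : Set.Icc ⊥ ω) ≤ ⟨σ, bot_le, hσ⟩ := by
      rw [← e.le_iff_le, he]
      exact Finset.singleton_subset_iff.2 hi
    have hvτ : (⟨v.1, hv⟩ : Set.Icc ⊥ ω) ≤ ⟨τ, bot_le, hτ⟩ :=
      mem_vertexSet.1 (h (mem_vertexSet.2 hvσ))
    rw [← e.le_iff_le, he] at hvτ
    exact Finset.singleton_subset_iff.1 hvτ
  exact e.le_iff_le.1 key

theorem eq_of_vertexSet_eq {σ τ ω : S} (hσ : σ ≤ ω) (hτ : τ ≤ ω)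
    (h : vertexSet σ = vertexSet τ) : σ = τ :=
  le_antisymm (hS.le_of_vertexSet_subset hσ hτ h.subset)
    (hS.le_of_vertexSet_subset hτ hσ h.superset)

theorem eq_bot_of_vertexSet_eq_empty {σ : S} (h : vertexSet σ = ∅) : σ = ⊥ :=
  hS.eq_of_vertexSet_eq le_rfl bot_le (h.trans vertexSet_bot.symm)

/-- Every set of vertices of a face spans a face of it. -/
theorem exists_le_vertexSet_eq {ω : S} {J : Finset (Vertex S)} (hJ : J ⊆ vertexSet ω) :
    ∃ σ ≤ ω, vertexSet σ = J := by
  classical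
  obtain ⟨n, ⟨e⟩⟩ := hS ω
  choose v hv he using exists_vertex_of_segment e
  let A : Finset (Fin n) := Finset.univ.filter fun i => v i ∈ J
  refine ⟨(e.symm A).1, (e.symm A).2.2, ?_⟩
  have key : ∀ w : Vertex S, ∀ hw : w.1 ∈ Set.Icc ⊥ ω, ∃ i, w = v i := by
    intro w hw
    have hne : (e ⟨w.1, hw⟩).Nonempty := by
      rw [Finset.nonempty_iff_ne_empty]
      intro h0
      have h1 : e ⟨w.1, hw⟩ ≤ e ⟨⊥, le_rfl, bot_le⟩ := h0 ▸ Finset.empty_subset _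
      exact w.2.1 (le_bot_iff.1 (e.le_iff_le.1 h1))
    obtain ⟨i, hi⟩ := hne
    have hle : (⟨(v i).1, hv i⟩ : Set.Icc ⊥ ω) ≤ ⟨w.1, hw⟩ := by
      rw [← e.le_iff_le, he]
      exact Finset.singleton_subset_iff.2 hi
    exact ⟨i, Subtype.ext ((w.2.le_iff_eq (v i).2.1).1 hle).symm⟩
  have key2 : ∀ i, (v i).1 ≤ (e.symm A).1 ↔ v i ∈ J := by
    intro i
    have h1 : (v i).1 ≤ (e.symm A).1 ↔ (⟨(v i).1, hv i⟩ : Set.Icc ⊥ ω) ≤ e.symm A := Iff.rfl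
    rw [h1, OrderIso.le_symm_apply, he]
    exact Finset.singleton_subset_iff.trans (by simp [A])
  ext w
  rw [mem_vertexSet]
  constructor
  · intro hw
    obtain ⟨i, rfl⟩ := key w ⟨bot_le, hw.trans (e.symm A).2.2⟩
    exact (key2 i).1 hw
  · intro hw
    obtain ⟨i, rfl⟩ := key w ⟨bot_le, mem_vertexSet.1 (hJ hw)⟩
    exact (key2 i).2 hw

theorem vertexSet_of_isGLB [DecidableEq (Vertex S)] {σ τ μ ω : S} (hσ : σ ≤ ω) (hτ : τ ≤ ω)
    (hμ : IsGLB {σ, τ} μ) : vertexSet μ = vertexSet σ ∩ vertexSet τ := by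
  obtain ⟨κ, hκ, hV⟩ := hS.exists_le_vertexSet_eq
    (Finset.inter_subset_left.trans (vertexSet_mono hσ) : vertexSet σ ∩ vertexSet τ ⊆ _)
  refine Finset.Subset.antisymm (Finset.subset_inter ?_ ?_) ?_
  · exact vertexSet_mono (hμ.1 (by simp))
  · exact vertexSet_mono (hμ.1 (by simp))
  · rw [← hV]
    refine vertexSet_mono (hμ.2 ?_)
    rintro _ (rfl | rfl)
    · exact hS.le_of_vertexSet_subset hκ hσ (hV.trans_subset Finset.inter_subset_left)
    · exact hS.le_of_vertexSet_subset hκ hτ (hV.trans_subset Finset.inter_subset_right)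

theorem exists_isGLB {σ τ ω : S} (hσ : σ ≤ ω) (hτ : τ ≤ ω) : ∃ μ, IsGLB {σ, τ} μ := by
  classical
  obtain ⟨κ, hκ, hV⟩ := hS.exists_le_vertexSet_eq
    (Finset.inter_subset_left.trans (vertexSet_mono hσ) : vertexSet σ ∩ vertexSet τ ⊆ _)
  refine ⟨κ, ?_, fun z hz => ?_⟩
  · rintro _ (rfl | rfl)
    · exact hS.le_of_vertexSet_subset hκ hσ (hV.trans_subset Finset.inter_subset_left)
    · exact hS.le_of_vertexSet_subset hκ hτ (hV.trans_subset Finset.inter_subset_right)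
  · have h1 : z ≤ σ := hz (by simp)
    have h2 : z ≤ τ := hz (by simp)
    refine hS.le_of_vertexSet_subset (h1.trans hσ) hκ ?_
    rw [hV]
    exact Finset.subset_inter (vertexSet_mono h1) (vertexSet_mono h2)

/-- Two faces of `ω` have exactly one minimal upper bound below `ω`, the face that is spanned by
the union of their vertex sets. -/
theorem exists_minimal_upperBound [DecidableEq (Vertex S)] {σ τ ω : S} (hσ : σ ≤ ω)
    (hτ : τ ≤ ω) : ∃ κ ≤ ω, vertexSet κ = vertexSet σ ∪ vertexSet τ ∧
      ∀ η ≤ ω, Minimal (· ∈ upperBounds {σ, τ}) η ↔ η = κ := by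
  obtain ⟨κ, hκ, hV⟩ := hS.exists_le_vertexSet_eq
    (Finset.union_subset (vertexSet_mono hσ) (vertexSet_mono hτ))
  have hub : ∀ {η}, η ∈ upperBounds {σ, τ} ↔ σ ≤ η ∧ τ ≤ η := by simp [upperBounds]
  have hκub : κ ∈ upperBounds {σ, τ} := hub.2
    ⟨hS.le_of_vertexSet_subset hσ hκ (by rw [hV]; exact Finset.subset_union_left),
      hS.le_of_vertexSet_subset hτ hκ (by rw [hV]; exact Finset.subset_union_right)⟩
  have hleast : ∀ η ≤ ω, η ∈ upperBounds {σ, τ} → κ ≤ η := fun η hη h =>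
    hS.le_of_vertexSet_subset hκ hη (by
      rw [hV]
      exact Finset.union_subset (vertexSet_mono (hub.1 h).1) (vertexSet_mono (hub.1 h).2))
  refine ⟨κ, hκ, hV, fun η hη => ⟨fun h => ?_, ?_⟩⟩
  · have h1 := hleast η hη h.1
    exact le_antisymm (h.2 hκub h1) h1
  · rintro rfl
    exact ⟨hκub, fun z hz hzη => hleast z (hzη.trans hη) hz⟩

theorem vertexSet_of_minimal [DecidableEq (Vertex S)] {σ τ η : S}
    (h : Minimal (· ∈ upperBounds {σ, τ}) η) :
    vertexSet η = vertexSet σ ∪ vertexSet τ := by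
  obtain ⟨κ, -, hV, hκ⟩ := hS.exists_minimal_upperBound (h.1 (by simp) : σ ≤ η)
    (h.1 (by simp) : τ ≤ η)
  rw [(hκ η le_rfl).1 h, hV]

end IsSimplicialPoset

end Faces

/-! ### Restriction of the face ring to the faces -/

section FaceRestriction

variable {S : Type*} [PartialOrder S] [OrderBot S] [Fintype S]

theorem vertexMonomial_bot : vertexMonomial (⊥ : S) = 1 := by
  rw [vertexMonomial, vertexSet_bot, Finset.prod_empty]

open Classical in
/-- The homomorphism `ℤ[v_σ] → ℤ[x_j]` that sends `v_σ` to `∏_{v ≤ σ} x_v` if `σ ≤ ω` and to `0`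
otherwise. -/
def polynomialRestrict (ω : S) : MvPolynomial S ℤ →+* MvPolynomial (Vertex S) ℤ :=
  MvPolynomial.eval₂Hom (Int.castRingHom _) fun σ => if σ ≤ ω then vertexMonomial σ else 0

open Classical in
theorem polynomialRestrict_X (ω σ : S) :
    polynomialRestrict ω (MvPolynomial.X σ) = if σ ≤ ω then vertexMonomial σ else 0 :=
  MvPolynomial.eval₂Hom_X' _ _ _

/-- The relations hold after restriction to `ω`: in the Boolean lattice `[⊥, ω]` only one minimal
upper bound survives, and meets and joins are intersections and unions of vertex sets. -/
theorem polynomialRestrict_eq_zero (hS : IsSimplicialPoset S) (ω : S) {p : MvPolynomial S ℤ}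
    (hp : p ∈ faceRelations S) : polynomialRestrict ω p = 0 := by
  classical
  rcases hp with (hp | ⟨σ, τ, μ, hμ, rfl⟩) | ⟨σ, τ, hb, rfl⟩
  · rw [Set.mem_singleton_iff.1 hp, map_sub, polynomialRestrict_X, if_pos bot_le,
      vertexMonomial_bot, map_one, sub_self]
  · rw [map_sub, map_mul, map_mul, map_sum]
    simp only [polynomialRestrict_X]
    by_cases h : σ ≤ ω ∧ τ ≤ ω
    · obtain ⟨hσ, hτ⟩ := h
      obtain ⟨κ, hκω, hV, hκ⟩ := hS.exists_minimal_upperBound hσ hτ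
      have hsum : ∑ η ∈ Finset.univ.filter (fun η => Minimal (· ∈ upperBounds {σ, τ}) η),
          (if η ≤ ω then vertexMonomial η else 0) = vertexMonomial κ := by
        rw [Finset.sum_eq_single κ, if_pos hκω]
        · intro η hη hne
          refine if_neg fun hηω => hne ?_
          exact (hκ η hηω).1 (Finset.mem_filter.1 hη).2
        · intro h
          exact absurd (Finset.mem_filter.2 ⟨Finset.mem_univ _, (hκ κ hκω).2 rfl⟩) h
      have hμω : μ ≤ ω := (hμ.1 (by simp : σ ∈ ({σ, τ} : Set S))).trans hσ
      rw [hsum, if_pos hσ, if_pos hτ, if_pos hμω, vertexMonomial, vertexMonomial, vertexMonomial,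
        vertexMonomial, hS.vertexSet_of_isGLB hσ hτ hμ, hV, mul_comm (∏ v ∈ _ ∩ _, _),
        Finset.prod_union_inter, sub_self]
    · have hsum : ∑ η ∈ Finset.univ.filter (fun η => Minimal (· ∈ upperBounds {σ, τ}) η),
          (if η ≤ ω then vertexMonomial η else (0 : MvPolynomial (Vertex S) ℤ)) = 0 := by
        refine Finset.sum_eq_zero fun η hη => if_neg fun hηω => h ?_
        have hη' := (Finset.mem_filter.1 hη).2.1
        exact ⟨(hη' (by simp)).trans hηω, (hη' (by simp)).trans hηω⟩
      rw [hsum, mul_zero, sub_zero]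
      rcases not_and_or.1 h with h | h <;> simp [h]
  · rw [map_mul, polynomialRestrict_X, polynomialRestrict_X]
    by_cases hσ : σ ≤ ω
    · rw [if_neg fun hτ : τ ≤ ω => hb ⟨ω, by simp [upperBounds, hσ, hτ]⟩, mul_zero]
    · rw [if_neg hσ, zero_mul]

/-- The restrictions of the face ring to the polynomial rings of all faces `ω`: the component at
`ω` sends `v_σ` to `∏_{v ≤ σ} x_v` if `σ ≤ ω` and to `0` otherwise. -/
def StanleyFaceRing.restriction (hS : IsSimplicialPoset S) :
    StanleyFaceRing S →+* (S → MvPolynomial (Vertex S) ℤ) :=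
  RingHom.pi fun ω => Ideal.Quotient.lift _ (polynomialRestrict ω) (fun p hp => by
    have h : Ideal.span (faceRelations S) ≤ RingHom.ker (polynomialRestrict ω) :=
      Ideal.span_le.2 fun q hq => polynomialRestrict_eq_zero hS ω hq
    exact h hp)

open Classical in
theorem StanleyFaceRing.restriction_v (hS : IsSimplicialPoset S) (σ ω : S) :
    StanleyFaceRing.restriction hS (StanleyFaceRing.v σ) ω =
      if σ ≤ ω then vertexMonomial σ else 0 :=
  polynomialRestrict_X ω σ

end FaceRestriction

/-! ### Chain monomials -/

/-- A homomorphism of abelian groups is injective if it maps a generating family to a family that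
has a dual family of functionals. -/
theorem injective_of_dual_family {I M N : Type*} [AddCommGroup M] [AddCommGroup N] (f : M →+ N)
    (m : I → M) (hm : AddSubgroup.closure (Set.range m) = ⊤) (φ : I → N →+ ℤ)
    (hself : ∀ i, φ i (f (m i)) = 1) (hne : ∀ i j, i ≠ j → φ i (f (m j)) = 0) :
    Function.Injective f := by
  classical
  rw [injective_iff_map_eq_zero]
  intro x hx
  have hx' : x ∈ Submodule.span ℤ (Set.range m) := by
    rw [← Submodule.mem_toAddSubgroup, Submodule.span_int_eq_addSubgroupClosure, hm]
    trivial
  obtain ⟨c, rfl⟩ := (Finsupp.mem_span_range_iff_exists_finsupp).1 hx'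
  have hc : c = 0 := by
    ext i
    have h := congrArg (φ i) hx
    rw [map_zero, Finsupp.sum, map_sum, map_sum] at h
    simp only [map_zsmul] at h
    rw [Finset.sum_eq_single i (fun j _ hj => by rw [hne i j hj.symm, smul_zero])
      (fun hi => by rw [Finsupp.notMem_support_iff.1 hi, zero_smul]), hself] at h
    simpa using h
  rw [hc, Finsupp.sum_zero_index]

section ChainMonomials

variable {S : Type*} [PartialOrder S] [OrderBot S] [Fintype S]

/-- The product of the generators `v_σ` over a multiset of faces. -/
def faceMonomial (t : Multiset S) : StanleyFaceRing S := (t.map StanleyFaceRing.v).prod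

theorem faceMonomial_cons (σ : S) (t : Multiset S) :
    faceMonomial (σ ::ₘ t) = StanleyFaceRing.v σ * faceMonomial t := by
  rw [faceMonomial, Multiset.map_cons, Multiset.prod_cons, faceMonomial]

/-- The multisets of nonempty faces that form a chain. -/
def IsChainMultiset (t : Multiset S) : Prop := ⊥ ∉ t ∧ ∀ σ ∈ t, ∀ τ ∈ t, σ ≤ τ ∨ τ ≤ σ

theorem StanleyFaceRing.v_bot : StanleyFaceRing.v (⊥ : S) = 1 := by
  refine (Ideal.Quotient.eq (I := Ideal.span (faceRelations S))).2 (Ideal.subset_span ?_)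
  exact Or.inl (Or.inl rfl)

theorem StanleyFaceRing.v_mul_v_of_not_bddAbove {σ τ : S} (h : ¬ BddAbove {σ, τ}) :
    StanleyFaceRing.v σ * StanleyFaceRing.v τ = 0 := by
  have hm := Ideal.Quotient.eq_zero_iff_mem.2
    (Ideal.subset_span (Or.inr ⟨σ, τ, h, rfl⟩) : _ ∈ Ideal.span (faceRelations S))
  rwa [map_mul] at hm

open Classical in
theorem StanleyFaceRing.v_mul_v {σ τ μ : S} (h : IsGLB {σ, τ} μ) :
    StanleyFaceRing.v σ * StanleyFaceRing.v τ = StanleyFaceRing.v μ *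
      ∑ η ∈ Finset.univ.filter (fun η => Minimal (· ∈ upperBounds {σ, τ}) η),
        StanleyFaceRing.v η := by
  have hm := Ideal.Quotient.eq_zero_iff_mem.2
    (Ideal.subset_span (Or.inl (Or.inr ⟨σ, τ, μ, h, rfl⟩)) : _ ∈ Ideal.span (faceRelations S))
  rw [map_sub, map_mul, map_mul, map_sum] at hm
  exact sub_eq_zero.1 hm

/-- The number of vertices of a face. -/
def rank (σ : S) : ℕ := (vertexSet σ).card

theorem sum_sq_le_sq_sum (t : Multiset ℕ) : (t.map (· ^ 2)).sum ≤ t.sum ^ 2 := by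
  induction t using Multiset.induction_on with
  | empty => simp
  | cons a t ih =>
    rw [Multiset.map_cons, Multiset.sum_cons, Multiset.sum_cons]
    nlinarith [Nat.zero_le (a * t.sum)]

theorem faceMonomial_filter_ne_bot [DecidableEq S] (t : Multiset S) :
    faceMonomial (t.filter (· ≠ ⊥)) = faceMonomial t := by
  induction t using Multiset.induction_on with
  | empty => rfl
  | cons σ t ih =>
    by_cases h : σ = ⊥
    · rw [Multiset.filter_cons_of_neg (p := (· ≠ ⊥)) _ (by simpa using h), ih, faceMonomial_cons, h,
        StanleyFaceRing.v_bot, one_mul]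
    · rw [Multiset.filter_cons_of_pos (p := (· ≠ ⊥)) _ h, faceMonomial_cons, faceMonomial_cons, ih]

/-- Straightening: every monomial is a combination of chain monomials. Replacing an incomparable
pair `σ, τ` by `σ ∧ τ` and a minimal upper bound preserves the sum of the ranks and increases the
sum of their squares. -/
theorem faceMonomial_mem_closure (hS : IsSimplicialPoset S) (t : Multiset S) :
    faceMonomial t ∈ AddSubgroup.closure
      (Set.range fun s : {s : Multiset S // IsChainMultiset s} => faceMonomial s.1) := by
  classical
  induction hk : (t.map rank).sum ^ 2 - (t.map fun σ => rank σ ^ 2).sum using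
    Nat.strong_induction_on generalizing t with | _ k ih => ?_
  by_cases hc : ∀ σ ∈ t, ∀ τ ∈ t, σ ≤ τ ∨ τ ≤ σ
  · rw [← faceMonomial_filter_ne_bot]
    refine AddSubgroup.subset_closure ⟨⟨t.filter (· ≠ ⊥), ?_, fun σ hσ τ hτ => ?_⟩, rfl⟩
    · simp
    · exact hc σ (Multiset.mem_of_mem_filter hσ) τ (Multiset.mem_of_mem_filter hτ)
  push Not at hc
  obtain ⟨σ, hσ, τ, hτ, hστ, hτσ⟩ := hc
  obtain ⟨t, rfl⟩ := Multiset.exists_cons_of_mem hσ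
  have hτ' : τ ∈ t := (Multiset.mem_cons.1 hτ).resolve_left fun h => hστ h.ge
  obtain ⟨t, rfl⟩ := Multiset.exists_cons_of_mem hτ'
  rw [faceMonomial_cons, faceMonomial_cons, ← mul_assoc]
  -- If there is no common upper bound, the monomial is zero; otherwise the meet exists.
  by_cases hb : BddAbove {σ, τ}
  swap
  · rw [StanleyFaceRing.v_mul_v_of_not_bddAbove hb, zero_mul]
    exact zero_mem _
  obtain ⟨ω, hω⟩ := hb
  have hσω : σ ≤ ω := hω (by simp)
  have hτω : τ ≤ ω := hω (by simp)
  obtain ⟨μ, hμ⟩ := hS.exists_isGLB hσω hτω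
  rw [StanleyFaceRing.v_mul_v hμ, Finset.mul_sum, Finset.sum_mul]
  refine sum_mem fun η hη => ?_
  have hη' := (Finset.mem_filter.1 hη).2
  have hση : σ ≤ η := hη'.1 (by simp)
  have hτη : τ ≤ η := hη'.1 (by simp)
  rw [mul_assoc, ← faceMonomial_cons, ← faceMonomial_cons]
  refine ih _ ?_ _ rfl
  rw [← hk]
  have hsum : rank μ + rank η = rank σ + rank τ := by
    rw [rank, rank, hS.vertexSet_of_isGLB hσω hτω hμ, hS.vertexSet_of_minimal hη', add_comm,
      Finset.card_union_add_card_inter]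
    rfl
  have h1 : rank μ < rank σ := by
    refine Finset.card_lt_card (lt_of_le_of_ne (vertexSet_mono (hμ.1 (by simp))) fun h => ?_)
    have e := hS.eq_of_vertexSet_eq ((hμ.1 (by simp : σ ∈ ({σ, τ} : Set S))).trans hσω) hσω h
    exact hστ (e ▸ hμ.1 (by simp))
  have h2 : rank μ < rank τ := by
    refine Finset.card_lt_card (lt_of_le_of_ne (vertexSet_mono (hμ.1 (by simp))) fun h => ?_)
    have e := hS.eq_of_vertexSet_eq ((hμ.1 (by simp : σ ∈ ({σ, τ} : Set S))).trans hσω) hτω h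
    exact hτσ (e ▸ hμ.1 (by simp))
  have hle := sum_sq_le_sq_sum ((μ ::ₘ η ::ₘ t).map rank)
  simp only [Multiset.map_map, Function.comp_def, Multiset.map_cons, Multiset.sum_cons,
    ← add_assoc, hsum] at hle ⊢
  -- With `|σ ∧ τ| = i`, `|σ| = i + a + 1`, `|τ| = i + b + 1` and `|η| = i + a + b + 2`, the sum of
  -- the squares grows by `2 (a + 1) (b + 1)`.
  refine Nat.sub_lt_sub_left (lt_of_lt_of_le ?_ hle) ?_ <;>
  · refine Nat.add_lt_add_right ?_ _
    obtain ⟨a, ha⟩ := Nat.exists_eq_add_of_lt h1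
    obtain ⟨b, hb⟩ := Nat.exists_eq_add_of_lt h2
    have hη3 : rank η = rank μ + a + b + 2 := by omega
    rw [hη3, ha, hb]
    nlinarith [Nat.zero_le (a * b)]

/-- The chain monomials generate the additive group of the face ring. -/
theorem closure_faceMonomial_eq_top (hS : IsSimplicialPoset S) :
    AddSubgroup.closure
      (Set.range fun s : {s : Multiset S // IsChainMultiset s} => faceMonomial s.1) = ⊤ := by
  have hle : AddSubgroup.closure (Set.range (faceMonomial (S := S))) ≤ AddSubgroup.closure
      (Set.range fun s : {s : Multiset S // IsChainMultiset s} => faceMonomial s.1) := by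
    rw [AddSubgroup.closure_le]
    rintro _ ⟨t, rfl⟩
    exact faceMonomial_mem_closure hS t
  have hmul : ∀ x ∈ AddSubgroup.closure (Set.range (faceMonomial (S := S))), ∀ σ,
      x * StanleyFaceRing.v σ ∈ AddSubgroup.closure (Set.range (faceMonomial (S := S))) := by
    intro x hx σ
    have h : AddSubgroup.closure (Set.range (faceMonomial (S := S))) ≤
        (AddSubgroup.closure (Set.range faceMonomial)).comap
          (AddMonoidHom.mulRight (StanleyFaceRing.v σ)) := by
      rw [AddSubgroup.closure_le]
      rintro _ ⟨t, rfl⟩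
      refine AddSubgroup.subset_closure ⟨σ ::ₘ t, ?_⟩
      rw [faceMonomial_cons, mul_comm]
      rfl
    exact h hx
  refine eq_top_iff.2 fun x hx => hle ?_
  clear hx
  obtain ⟨p, rfl⟩ := Ideal.Quotient.mk_surjective x
  induction p using MvPolynomial.induction_on with
  | C a =>
    have h1 : (1 : StanleyFaceRing S) ∈ AddSubgroup.closure (Set.range (faceMonomial (S := S))) :=
      AddSubgroup.subset_closure ⟨0, rfl⟩
    have h2 := zsmul_mem h1 a
    rw [zsmul_one] at h2
    have h3 : (MvPolynomial.C a : MvPolynomial S ℤ) = (a : MvPolynomial S ℤ) := by simp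
    rwa [h3, map_intCast]
  | add p q hp hq => rw [map_add]; exact add_mem hp hq
  | mul_X p σ hp => rw [map_mul]; exact hmul _ hp σ

/-- The exponent vector of `∏_{v ≤ σ} x_v`. -/
def vertexExponent (σ : S) : Vertex S →₀ ℕ := Finsupp.indicator (vertexSet σ) fun _ _ => 1

theorem vertexExponent_apply_of_le {σ : S} {v : Vertex S} (h : v.1 ≤ σ) :
    vertexExponent σ v = 1 :=
  Finsupp.indicator_of_mem (mem_vertexSet.2 h) _

theorem vertexExponent_apply_of_not_le {σ : S} {v : Vertex S} (h : ¬ v.1 ≤ σ) :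
    vertexExponent σ v = 0 :=
  Finsupp.indicator_of_notMem (fun h' => h (mem_vertexSet.1 h')) _

theorem vertexMonomial_eq_monomial (σ : S) :
    vertexMonomial σ = MvPolynomial.monomial (vertexExponent σ) 1 := by
  classical
  rw [MvPolynomial.monomial_eq, MvPolynomial.C_1, one_mul, vertexMonomial, vertexExponent,
    Finsupp.prod_indicator_index]
  · simp
  · simp

/-- The exponent vector of the image of a product of generators. -/
def totalExponent (t : Multiset S) : Vertex S →₀ ℕ := (t.map vertexExponent).sum

theorem totalExponent_cons (σ : S) (t : Multiset S) :
    totalExponent (σ ::ₘ t) = vertexExponent σ + totalExponent t := by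
  rw [totalExponent, Multiset.map_cons, Multiset.sum_cons, totalExponent]

open Classical in
theorem restriction_faceMonomial (hS : IsSimplicialPoset S) (t : Multiset S) (ω : S) :
    StanleyFaceRing.restriction hS (faceMonomial t) ω =
      if ∀ σ ∈ t, σ ≤ ω then MvPolynomial.monomial (totalExponent t) 1 else 0 := by
  induction t using Multiset.induction_on with
  | empty =>
    rw [if_pos (by simp)]
    simp [faceMonomial, totalExponent]
  | cons σ t ih =>
    rw [faceMonomial_cons, map_mul, Pi.mul_apply, ih, StanleyFaceRing.restriction_v,
      totalExponent_cons]
    by_cases h1 : σ ≤ ω <;> by_cases h2 : ∀ σ ∈ t, σ ≤ ω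
    · rw [if_pos h1, if_pos h2, if_pos (by simpa [h1] using h2), vertexMonomial_eq_monomial,
        MvPolynomial.monomial_mul, one_mul]
    · rw [if_neg h2, mul_zero, if_neg fun h => h2 fun σ hσ => h σ (Multiset.mem_cons_of_mem hσ)]
    all_goals rw [if_neg h1, zero_mul, if_neg fun h => h1 (h σ (Multiset.mem_cons_self _ _))]

/-- A nonempty chain has a largest element. -/
theorem IsChainMultiset.exists_cons {S : Type*} [PartialOrder S] [OrderBot S] {t : Multiset S}
    (ht : IsChainMultiset t) (h0 : t ≠ 0) :
    ∃ σ s, t = σ ::ₘ s ∧ IsChainMultiset s ∧ σ ≠ ⊥ ∧ ∀ τ ∈ t, τ ≤ σ := by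
  classical
  obtain ⟨σ, hσ⟩ := t.toFinset.exists_maximal (Multiset.toFinset_nonempty.2 h0)
  have hσt : σ ∈ t := Multiset.mem_toFinset.1 hσ.1
  obtain ⟨s, rfl⟩ := Multiset.exists_cons_of_mem hσt
  refine ⟨σ, s, rfl, ⟨fun h => ht.1 (Multiset.mem_cons_of_mem h), fun τ hτ τ' hτ' =>
    ht.2 τ (Multiset.mem_cons_of_mem hτ) τ' (Multiset.mem_cons_of_mem hτ')⟩, ?_, fun τ hτ => ?_⟩
  · rintro rfl
    exact ht.1 hσt
  · exact (ht.2 τ hτ σ hσt).elim id fun h => hσ.2 (Multiset.mem_toFinset.2 hτ) h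

theorem totalExponent_apply_ne_zero {t : Multiset S} {v : Vertex S} :
    totalExponent t v ≠ 0 ↔ ∃ σ ∈ t, v.1 ≤ σ := by
  induction t using Multiset.induction_on with
  | empty => simp [totalExponent]
  | cons σ t ih =>
    rw [totalExponent_cons, Finsupp.add_apply]
    simp only [Multiset.mem_cons, or_and_right, exists_or, exists_eq_left]
    rw [← ih]
    by_cases h : v.1 ≤ σ
    · simp [vertexExponent_apply_of_le h, h]
    · simp [vertexExponent_apply_of_not_le h, h]

/-- A chain of faces of `ω` is determined by its exponent vector: the largest face is spanned by
the support of the exponent vector, and is then split off. -/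
theorem eq_of_totalExponent_eq (hS : IsSimplicialPoset S) {ω : S} {t t' : Multiset S}
    (ht : IsChainMultiset t) (ht' : IsChainMultiset t') (hω : ∀ σ ∈ t, σ ≤ ω)
    (hω' : ∀ σ ∈ t', σ ≤ ω) (h : totalExponent t = totalExponent t') : t = t' := by
  have hzero : ∀ s : Multiset S, IsChainMultiset s → totalExponent s = 0 → s = 0 := by
    intro s hs h0
    by_contra hne
    obtain ⟨σ, s, rfl, -, hσ, -⟩ := hs.exists_cons hne
    refine hσ (hS.eq_bot_of_vertexSet_eq_empty (Finset.eq_empty_of_forall_notMem fun v hv => ?_))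
    exact totalExponent_apply_ne_zero.2 ⟨σ, Multiset.mem_cons_self _ _, mem_vertexSet.1 hv⟩
      (by rw [h0]; rfl)
  have hsupp : ∀ {σ : S} {s : Multiset S}, (∀ τ ∈ σ ::ₘ s, τ ≤ σ) → ∀ v : Vertex S,
      v ∈ vertexSet σ ↔ totalExponent (σ ::ₘ s) v ≠ 0 := by
    intro σ s hs v
    rw [totalExponent_apply_ne_zero, mem_vertexSet]
    exact ⟨fun hv => ⟨σ, Multiset.mem_cons_self _ _, hv⟩, fun ⟨τ, hτ, hv⟩ => hv.trans (hs τ hτ)⟩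
  induction hn : t.card generalizing t t' with
  | zero =>
    obtain rfl := Multiset.card_eq_zero.1 hn
    exact (hzero t' ht' h.symm).symm
  | succ n ih =>
    have hne : t ≠ 0 := by rintro rfl; simp at hn
    have hne' : t' ≠ 0 := by rintro rfl; exact hne (hzero t ht h)
    obtain ⟨σ, s, rfl, hs, -, hσ⟩ := ht.exists_cons hne
    obtain ⟨σ', s', rfl, hs', -, hσ'⟩ := ht'.exists_cons hne'
    have hσσ' : σ = σ' := by
      refine hS.eq_of_vertexSet_eq (hω σ (Multiset.mem_cons_self _ _))
        (hω' σ' (Multiset.mem_cons_self _ _)) (Finset.ext fun v => ?_)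
      rw [hsupp hσ, hsupp hσ', h]
    subst hσσ'
    congr 1
    rw [totalExponent_cons, totalExponent_cons] at h
    exact ih hs hs' (fun τ hτ => hω τ (Multiset.mem_cons_of_mem hτ))
      (fun τ hτ => hω' τ (Multiset.mem_cons_of_mem hτ)) (add_left_cancel h) (by simpa using hn)

/-- The face ring embeds into the product of the polynomial rings of its faces. -/
theorem StanleyFaceRing.restriction_injective (hS : IsSimplicialPoset S) :
    Function.Injective (StanleyFaceRing.restriction hS) := by
  classical
  have htop : ∀ t : {t : Multiset S // IsChainMultiset t}, ∃ σ : S, ∀ τ ∈ t.1, τ ≤ σ := by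
    rintro ⟨t, ht⟩
    by_cases h0 : t = 0
    · exact ⟨⊥, by simp [h0]⟩
    · obtain ⟨σ, s, rfl, -, -, hσ⟩ := ht.exists_cons h0
      exact ⟨σ, hσ⟩
  choose top htop using htop
  refine injective_of_dual_family (StanleyFaceRing.restriction hS : StanleyFaceRing S →+ _) _
    (closure_faceMonomial_eq_top hS)
    (fun t => (MvPolynomial.coeffAddMonoidHom (totalExponent t.1)).comp
      (Pi.evalAddMonoidHom (fun _ => MvPolynomial (Vertex S) ℤ) (top t)))
    (fun t => ?_) (fun t s hts => ?_)
  · change MvPolynomial.coeff _ (StanleyFaceRing.restriction hS (faceMonomial t.1) (top t)) = 1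
    rw [restriction_faceMonomial, if_pos (htop t), MvPolynomial.coeff_monomial, if_pos rfl]
  · change MvPolynomial.coeff _ (StanleyFaceRing.restriction hS (faceMonomial s.1) (top t)) = 0
    rw [restriction_faceMonomial]
    by_cases h : ∀ σ ∈ s.1, σ ≤ top t
    · rw [if_pos h, MvPolynomial.coeff_monomial, if_neg]
      exact fun e => hts (Subtype.ext (eq_of_totalExponent_eq hS t.2 s.2 (htop t) h e.symm))
    · rw [if_neg h, MvPolynomial.coeff_zero]

open Classical in
/-- The family `([σ ≤ ω] x^a)_ω`, where the support of `a` is the vertex set of `σ`, lies in the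
image of the face ring: split off one copy of each vertex of `σ` from `a`. -/
theorem exists_restriction_eq_monomial (hS : IsSimplicialPoset S) (a : Vertex S →₀ ℕ) (σ : S)
    (h : a.support = vertexSet σ) : ∃ x, ∀ ω, StanleyFaceRing.restriction hS x ω =
      if σ ≤ ω then MvPolynomial.monomial a 1 else 0 := by
  induction a using WellFoundedLT.induction generalizing σ with | _ a ih => ?_
  by_cases hσ : σ = ⊥
  · subst hσ
    rw [vertexSet_bot, Finsupp.support_eq_empty] at h
    refine ⟨1, fun ω => ?_⟩
    rw [map_one, if_pos bot_le, h]
    rfl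
  have hmem : ∀ v, a v ≠ 0 ↔ v.1 ≤ σ := fun v => by
    rw [← mem_vertexSet, ← h, Finsupp.mem_support_iff]
  have hle : vertexExponent σ ≤ a := fun v => by
    by_cases hv : v.1 ≤ σ
    · rw [vertexExponent_apply_of_le hv]
      exact Nat.one_le_iff_ne_zero.2 ((hmem v).2 hv)
    · rw [vertexExponent_apply_of_not_le hv]
      exact Nat.zero_le _
  obtain ⟨b, rfl⟩ := exists_add_of_le hle
  have hb : b.support ⊆ vertexSet σ := fun v hv => by
    rw [← h, Finsupp.mem_support_iff, Finsupp.add_apply]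
    have := Finsupp.mem_support_iff.1 hv
    omega
  have hlt : b < vertexExponent σ + b := by
    refine lt_of_le_of_ne le_add_self fun e => hσ ?_
    have h0 : vertexExponent σ = 0 := by simpa using e
    refine hS.eq_bot_of_vertexSet_eq_empty (Finset.eq_empty_of_forall_notMem fun v hv => ?_)
    have h1 := vertexExponent_apply_of_le (mem_vertexSet.1 hv)
    rw [h0] at h1
    exact zero_ne_one h1
  obtain ⟨τ, hτ, hV⟩ := hS.exists_le_vertexSet_eq hb
  obtain ⟨x, hx⟩ := ih b hlt τ hV.symm
  refine ⟨StanleyFaceRing.v σ * x, fun ω => ?_⟩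
  rw [map_mul, Pi.mul_apply, hx, StanleyFaceRing.restriction_v]
  by_cases hω : σ ≤ ω
  · rw [if_pos hω, if_pos hω, if_pos (hτ.trans hω), vertexMonomial_eq_monomial,
      MvPolynomial.monomial_mul, one_mul]
  · rw [if_neg hω, if_neg hω, zero_mul]

end ChainMonomials

/-! ### The dual faces of the cone -/

section DualFaces

variable {S : Type*} [PartialOrder S] [OrderBot S]

/-- The element of `S` that labels a vertex of the cone; the apex is labelled by `⊥`, so that the
cone is the realization of the order complex of `S`. -/
def toFace : Option (Simplex S) → S
  | none => ⊥
  | some σ => σ.1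

open Classical in
/-- The vertex of the cone that is labelled by `σ`. -/
def ofFace (σ : S) : Option (Simplex S) := if h : σ = ⊥ then none else some ⟨σ, h⟩

theorem toFace_ofFace (σ : S) : toFace (ofFace σ) = σ := by
  by_cases h : σ = ⊥
  · rw [ofFace, dif_pos h, h]; rfl
  · rw [ofFace, dif_neg h]; rfl

theorem some_eq_ofFace_iff {σ : S} {τ : Simplex S} : some τ = ofFace σ ↔ τ.1 = σ := by
  by_cases h : σ = ⊥
  · rw [ofFace, dif_pos h]
    exact iff_of_false (by simp) fun h' => τ.2 (h'.trans h)
  · rw [ofFace, dif_neg h, Option.some_inj, Subtype.ext_iff]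

variable [Fintype S]

/-- The realization of `S_{≥ σ}` as a subspace of the cone: the face `F_σ` if `σ ≠ ⊥`, and the
whole cone if `σ = ⊥`. -/
def dualFace (σ : S) : Set (ConeSpace S) := {t | ∀ i, t.1 i ≠ 0 → σ ≤ toFace i}

theorem face_eq_dualFace (σ : Simplex S) : face σ = dualFace σ.1 := by
  ext t
  constructor
  · rintro ⟨h0, h⟩ (_ | τ) hi
    · exact absurd h0 hi
    · exact h τ hi
  · intro h
    refine ⟨by_contra fun h0 => σ.2 (le_bot_iff.1 (h none h0)), fun τ hτ => h (some τ) hτ⟩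

theorem isClosed_dualFace (σ : S) : IsClosed (dualFace σ) := by
  have h : dualFace σ = ⋂ i, ⋂ _ : ¬ σ ≤ toFace i, {t : ConeSpace S | t.1 i = 0} := by
    ext t
    simp only [dualFace, Set.mem_ofPred_eq, Set.mem_iInter]
    exact forall_congr' fun i => not_imp_comm
  rw [h]
  exact isClosed_iInter fun i => isClosed_iInter fun _ =>
    isClosed_eq ((continuous_apply i).comp continuous_subtype_val) continuous_const

theorem mem_inter_conePanels {J : Finset (Vertex S)} {t : ConeSpace S} :
    t ∈ (conePanels S).inter J ↔ ∀ i, t.1 i ≠ 0 → J ⊆ vertexSet (toFace i) := by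
  have h : t ∈ (conePanels S).inter J ↔ ∀ v ∈ J, t ∈ dualFace v.1 := by
    simp only [PanelStructure.inter, Set.mem_iInter, conePanels, face_eq_dualFace]
    rfl
  rw [h]
  exact ⟨fun h i hi v hv => mem_vertexSet.2 (h v hv i hi),
    fun h v hv i hi => mem_vertexSet.1 (h i hi hv)⟩

theorem dualFace_subset_inter {J : Finset (Vertex S)} {σ : S} (h : vertexSet σ = J) :
    dualFace σ ⊆ (conePanels S).inter J := fun _ ht =>
  mem_inter_conePanels.2 fun i hi => h ▸ vertexSet_mono (ht i hi)

/-- The simplex of the order complex that carries a point has a least vertex. -/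
theorem exists_least_label (t : ConeSpace S) :
    ∃ i, t.1 i ≠ 0 ∧ ∀ j, t.1 j ≠ 0 → toFace i ≤ toFace j := by
  classical
  by_cases h0 : t.1 none = 0
  · obtain ⟨i, hi⟩ : ∃ i, t.1 i ≠ 0 := by
      by_contra! h
      have h1 := t.2.1.2
      simp [h] at h1
    obtain ⟨σ, rfl⟩ : ∃ σ, i = some σ := by
      cases i with
      | none => exact absurd h0 hi
      | some σ => exact ⟨σ, rfl⟩
    obtain ⟨μ, hμ⟩ := (Finset.univ.filter fun σ : Simplex S => t.1 (some σ) ≠ 0).exists_minimal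
      ⟨σ, by simpa using hi⟩
    have hμt : t.1 (some μ) ≠ 0 := (Finset.mem_filter.1 hμ.1).2
    refine ⟨some μ, hμt, ?_⟩
    rintro (_ | τ) hτ
    · exact absurd h0 hτ
    · rcases eq_or_ne μ τ with rfl | hne
      · exact le_rfl
      · exact (t.2.2 hμt hτ hne).elim id fun h =>
          hμ.2 (Finset.mem_filter.2 ⟨Finset.mem_univ _, hτ⟩) h
  · exact ⟨none, h0, fun j _ => bot_le⟩

/-- `P_{∩J}` is covered by the dual faces `F_σ` with vertex set `J`: take the face with vertex set
`J` of the least label of the point. -/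
theorem exists_mem_dualFace (hS : IsSimplicialPoset S) {J : Finset (Vertex S)} {t : ConeSpace S}
    (ht : t ∈ (conePanels S).inter J) : ∃ σ, vertexSet σ = J ∧ t ∈ dualFace σ := by
  obtain ⟨i, hi, hmin⟩ := exists_least_label t
  obtain ⟨σ, hσ, hV⟩ := hS.exists_le_vertexSet_eq (mem_inter_conePanels.1 ht i hi)
  exact ⟨σ, hV, fun j hj => hσ.trans (hmin j hj)⟩

/-- Distinct faces with the same vertex set have disjoint dual faces. -/
theorem eq_of_mem_dualFace (hS : IsSimplicialPoset S) {σ τ : S} (h : vertexSet σ = vertexSet τ)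
    {t : ConeSpace S} (hσ : t ∈ dualFace σ) (hτ : t ∈ dualFace τ) : σ = τ := by
  obtain ⟨i, hi, -⟩ := exists_least_label t
  exact hS.eq_of_vertexSet_eq (hσ i hi) (hτ i hi) h

open Classical in
/-- The vertex of the cone that is labelled by `σ`, as a point. -/
def conePoint (σ : S) : ConeSpace S :=
  ⟨Pi.single (ofFace σ) 1, single_mem_stdSimplex ℝ _, fun τ hτ τ' hτ' hne => by
    have key : ∀ {ω : Simplex S}, (Pi.single (ofFace σ) 1 : Option (Simplex S) → ℝ) (some ω) ≠ 0 →
        ω.1 = σ := fun {ω} hω => some_eq_ofFace_iff.1 (by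
      by_contra h
      exact hω (Pi.single_eq_of_ne h _))
    exact absurd (Subtype.ext ((key hτ).trans (key hτ').symm)) hne⟩

theorem conePoint_apply_ne_zero {σ : S} {i : Option (Simplex S)} :
    (conePoint σ).1 i ≠ 0 ↔ i = ofFace σ := by
  classical
  simp [conePoint, Pi.single_apply]

theorem conePoint_mem_dualFace {σ τ : S} : conePoint σ ∈ dualFace τ ↔ τ ≤ σ := by
  constructor
  · intro h
    have := h (ofFace σ) (conePoint_apply_ne_zero.2 rfl)
    rwa [toFace_ofFace] at this
  · intro h i hi
    rw [conePoint_apply_ne_zero.1 hi, toFace_ofFace]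
    exact h

open Classical in
/-- The segment from a point of `F_σ` to the vertex `σ` lies in `F_σ`. -/
def segmentPoint (σ : S) (t : dualFace σ) (r : unitInterval) : dualFace σ := by
  have hmem : ∀ i, (1 - (r : ℝ)) * t.1.1 i + r * (conePoint σ).1 i ≠ 0 →
      t.1.1 i ≠ 0 ∨ i = ofFace σ := by
    intro i hi
    by_contra! h
    apply hi
    rw [h.1, not_not.1 fun h' => h.2 (conePoint_apply_ne_zero.1 h')]
    ring
  refine ⟨⟨fun i => (1 - (r : ℝ)) * t.1.1 i + r * (conePoint σ).1 i, ?_, ?_⟩, ?_⟩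
  · exact convex_stdSimplex ℝ _ t.1.2.1 (conePoint σ).2.1 (sub_nonneg.2 r.2.2) r.2.1 (by ring)
  · intro τ hτ τ' hτ' hne
    rcases hmem _ hτ with h | h <;> rcases hmem _ hτ' with h' | h'
    · exact t.1.2.2 h h' hne
    · exact Or.inr (some_eq_ofFace_iff.1 h' ▸ t.2 _ h : τ'.1 ≤ τ.1)
    · exact Or.inl (some_eq_ofFace_iff.1 h ▸ t.2 _ h' : τ.1 ≤ τ'.1)
    · exact absurd (Option.some_inj.1 (h.trans h'.symm)) hne
  · intro i hi
    rcases hmem i hi with h | rfl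
    · exact t.2 i h
    · rw [toFace_ofFace]

theorem segmentPoint_apply (σ : S) (t : dualFace σ) (r : unitInterval) (i : Option (Simplex S)) :
    (segmentPoint σ t r).1.1 i = (1 - (r : ℝ)) * t.1.1 i + r * (conePoint σ).1 i := rfl

/-- The linear contraction of `F_σ` to the vertex `σ`. -/
def dualFaceContraction (σ : S) : C(dualFace σ × unitInterval, dualFace σ) where
  toFun p := segmentPoint σ p.1 p.2
  continuous_toFun := by
    refine Continuous.subtype_mk (Continuous.subtype_mk (continuous_pi fun i => ?_) _) _
    have h : Continuous fun p : dualFace σ × unitInterval => p.1.1.1 i :=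
      (continuous_apply i).comp
        (continuous_subtype_val.comp (continuous_subtype_val.comp continuous_fst))
    have hr : Continuous fun p : dualFace σ × unitInterval => (p.2 : ℝ) :=
      continuous_subtype_val.comp continuous_snd
    exact ((continuous_const.sub hr).mul h).add (hr.mul continuous_const)

/-- `F_σ` is contractible, so its cohomology ring is generated by `1`. -/
theorem exists_eq_zsmul_one_of_dualFace (σ : S) (a : CohomologyRing (dualFace σ)) :
    ∃ k : ℤ, a = k • 1 := by
  refine CohomologyRing.exists_eq_zsmul_one (H := dualFaceContraction σ)
    (x₀ := ⟨conePoint σ, conePoint_mem_dualFace.2 le_rfl⟩) (fun t => ?_) (fun t => ?_) a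
  · refine Subtype.ext (Subtype.ext (funext fun i => ?_))
    refine (segmentPoint_apply σ t 0 i).trans ?_
    simp
  · refine Subtype.ext (Subtype.ext (funext fun i => ?_))
    refine (segmentPoint_apply σ t 1 i).trans ?_
    simp

end DualFaces

/-! ### Cohomology of the intersections of panels -/

section Inter

theorem monomial_mem_exactMonomials {ι : Type*} {J : Finset ι} {a : ι →₀ ℕ}
    (h : a.support = J) :
    MvPolynomial.monomial a 1 ∈ exactMonomials J :=
  Submodule.subset_span ⟨a, h, rfl⟩

variable {S : Type*} [PartialOrder S] [OrderBot S] [Fintype S] {J : Finset (Vertex S)}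

/-- The complement of a component of `P_{∩J}` is the finite union of the other components. -/
theorem isClopen_dualFace (hS : IsSimplicialPoset S) {σ : S} (h : vertexSet σ = J) :
    IsClopen {t : (conePanels S).inter J | t.1 ∈ dualFace σ} := by
  have hc : ∀ τ : S, IsClosed {t : (conePanels S).inter J | t.1 ∈ dualFace τ} := fun τ =>
    (isClosed_dualFace τ).preimage continuous_subtype_val
  refine ⟨hc σ, isClosed_compl_iff.1 ?_⟩
  have hcompl : {t : (conePanels S).inter J | t.1 ∈ dualFace σ}ᶜ =
      ⋃ τ : {τ : S // vertexSet τ = J ∧ τ ≠ σ}, {t | t.1 ∈ dualFace τ.1} := by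
    ext t
    simp only [Set.mem_compl_iff, Set.mem_ofPred_eq, Set.mem_iUnion]
    constructor
    · intro ht
      obtain ⟨τ, hV, hτ⟩ := exists_mem_dualFace hS t.2
      exact ⟨⟨τ, hV, fun e => ht (e ▸ hτ)⟩, hτ⟩
    · rintro ⟨⟨τ, hV, hne⟩, hτ⟩ hσ
      exact hne (eq_of_mem_dualFace hS (hV.trans h.symm) hτ hσ)
  rw [hcompl]
  exact isClosed_iUnion_of_finite fun τ => hc τ

/-- The class of `P_{∩J}` that is `1` on the component `F_σ` and `0` on the other components. -/
def componentClass (hS : IsSimplicialPoset S) {σ : S} (h : vertexSet σ = J) :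
    CohomologyRing ((conePanels S).inter J) :=
  clopenClass _ (isClopen_dualFace hS h)

open Classical in
theorem restrict_componentClass (hS : IsSimplicialPoset S) {σ τ : S} (hσ : vertexSet σ = J)
    {A : Set (ConeSpace S)} (hA : A = dualFace τ) (hτ : vertexSet τ = J)
    (hsub : A ⊆ (conePanels S).inter J) :
    restrict hsub (componentClass hS hσ) = if τ = σ then 1 else 0 := by
  subst hA
  split_ifs with h
  · subst h
    exact map_clopenClass_eq_one fun t => t.2
  · exact map_clopenClass_eq_zero fun t ht =>
      h (eq_of_mem_dualFace hS (hτ.trans hσ.symm) t.2 ht)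

open Classical in
/-- The component classes generate the cohomology of `P_{∩J}`, since the components are
contractible. -/
theorem exists_eq_sum_componentClass (hS : IsSimplicialPoset S)
    (a : CohomologyRing ((conePanels S).inter J)) :
    ∃ k : {σ : S // vertexSet σ = J} → ℤ, a = ∑ σ, k σ • componentClass hS σ.2 := by
  choose k hk using fun σ : {σ : S // vertexSet σ = J} =>
    exists_eq_zsmul_one_of_dualFace σ.1 (restrict (dualFace_subset_inter σ.2) a)
  refine ⟨k, sub_eq_zero.1 ?_⟩
  refine CohomologyRing.eq_zero_of_restrict_eq_zero
    (A := fun σ : {σ : S // vertexSet σ = J} => dualFace σ.1)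
    (fun σ => dualFace_subset_inter σ.2) (fun t ht => ?_) (fun σ τ t hσ hτ => ?_)
    (fun σ => isClosed_dualFace σ.1) _ (fun τ => ?_)
  · obtain ⟨σ, hV, hσ⟩ := exists_mem_dualFace hS ht
    exact Set.mem_iUnion.2 ⟨⟨σ, hV⟩, hσ⟩
  · exact Subtype.ext (eq_of_mem_dualFace hS (σ.2.trans τ.2.symm) hσ hτ)
  · rw [map_sub, hk, map_sum, Finset.sum_eq_single τ]
    · rw [map_zsmul, restrict_componentClass hS τ.2 rfl τ.2, if_pos rfl, sub_self]
    · intro σ _ hne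
      rw [map_zsmul, restrict_componentClass hS σ.2 rfl τ.2,
        if_neg fun h => hne (Subtype.ext h).symm, zsmul_zero]
    · exact fun h => absurd (Finset.mem_univ _) h

/-! ### The topological face ring as a ring of polynomial families -/

/-- The evaluations of the topological face ring at the vertices of the cone. -/
def TopologicalFaceRing.restriction (S : Type*) [PartialOrder S] [OrderBot S] [Fintype S] :
    TopologicalFaceRing (conePanels S) →+* (S → MvPolynomial (Vertex S) ℤ) :=
  RingHom.pi fun ω => TopologicalFaceRing.eval (conePanels S) (conePoint ω)

open Classical in
theorem TopologicalFaceRing.restriction_of (hS : IsSimplicialPoset S) {σ : S}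
    (hσ : vertexSet σ = J) (f : exactMonomials J) (ω : S) :
    TopologicalFaceRing.restriction S
      (TopologicalFaceRing.of (conePanels S) J (componentClass hS hσ ⊗ₜ f)) ω =
        if σ ≤ ω then f.1 else 0 := by
  refine (TopologicalFaceRing.eval_of (conePanels S) (conePoint ω) J _).trans ?_
  refine (summandEval_tmul (conePanels S) (conePoint ω) J _ f).trans ?_
  by_cases hm : conePoint ω ∈ (conePanels S).inter J
  · refine (congrArg (· • f.1) ((subspaceEval_of_mem hm _).trans
      (pointEval_clopenClass _ (isClopen_dualFace hS hσ)))).trans ?_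
    have hiff : (⟨conePoint ω, hm⟩ : (conePanels S).inter J) ∈
        {t : (conePanels S).inter J | t.1 ∈ dualFace σ} ↔ σ ≤ ω := conePoint_mem_dualFace
    by_cases h : σ ≤ ω
    · rw [if_pos h, Set.indicator_of_mem (hiff.2 h)]
      exact one_smul _ _
    · rw [if_neg h, Set.indicator_of_notMem fun h' => h (hiff.1 h')]
      exact zero_smul _ _
  · refine (congrArg (· • f.1) (subspaceEval_of_notMem hm _)).trans ?_
    rw [if_neg fun h => hm (dualFace_subset_inter hσ (conePoint_mem_dualFace.2 h))]
    exact zero_smul _ _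

/-- The elements `e_σ ⊗ x^a`, where the support of `a` is the vertex set of `σ`. -/
def basisElement (hS : IsSimplicialPoset S)
    (q : {q : S × (Vertex S →₀ ℕ) // q.2.support = vertexSet q.1}) :
    TopologicalFaceRing (conePanels S) :=
  TopologicalFaceRing.of (conePanels S) (vertexSet q.1.1)
    (componentClass hS rfl ⊗ₜ ⟨_, monomial_mem_exactMonomials q.2⟩)

theorem closure_basisElement_eq_top (hS : IsSimplicialPoset S) :
    AddSubgroup.closure (Set.range (basisElement hS)) = ⊤ := by
  refine eq_top_iff.2 fun x hx => ?_
  clear hx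
  induction x using TopologicalFaceRing.induction_on with
  | zero => exact zero_mem _
  | add x y hx hy => exact add_mem hx hy
  | of J a f =>
    obtain ⟨k, rfl⟩ := exists_eq_sum_componentClass hS a
    rw [TensorProduct.sum_tmul, map_sum]
    refine sum_mem fun σ _ => ?_
    obtain ⟨σ, rfl⟩ := σ
    rw [← TensorProduct.smul_tmul', map_zsmul]
    refine zsmul_mem ?_ _
    obtain ⟨f, hf⟩ := f
    induction hf using Submodule.span_induction with
    | mem f hf =>
      obtain ⟨a, ha, rfl⟩ := hf
      exact AddSubgroup.subset_closure ⟨⟨(σ, a), ha⟩, rfl⟩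
    | zero =>
      have h : (⟨0, zero_mem _⟩ : exactMonomials (vertexSet σ)) = 0 := rfl
      rw [h, TensorProduct.tmul_zero, map_zero]
      exact zero_mem _
    | add f g hf hg ihf ihg =>
      have h : (⟨f + g, add_mem hf hg⟩ : exactMonomials (vertexSet σ)) = ⟨f, hf⟩ + ⟨g, hg⟩ := rfl
      rw [h, TensorProduct.tmul_add, map_add]
      exact add_mem ihf ihg
    | smul c f hf ih =>
      have h : (⟨c • f, Submodule.smul_mem _ c hf⟩ : exactMonomials (vertexSet σ)) =
        c • ⟨f, hf⟩ := rfl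
      rw [h, TensorProduct.tmul_smul, map_zsmul]
      exact zsmul_mem ih c

/-- The topological face ring embeds into the product of the polynomial rings of the faces. -/
theorem TopologicalFaceRing.restriction_injective (hS : IsSimplicialPoset S) :
    Function.Injective (TopologicalFaceRing.restriction S) := by
  classical
  refine injective_of_dual_family
    (TopologicalFaceRing.restriction S : TopologicalFaceRing (conePanels S) →+ _) _
    (closure_basisElement_eq_top hS)
    (fun q => (MvPolynomial.coeffAddMonoidHom q.1.2).comp
      (Pi.evalAddMonoidHom (fun _ => MvPolynomial (Vertex S) ℤ) q.1.1))
    (fun q => ?_) (fun q r hqr => ?_)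
  · change MvPolynomial.coeff _ (TopologicalFaceRing.restriction S (basisElement hS q) q.1.1) = 1
    rw [basisElement, TopologicalFaceRing.restriction_of, if_pos le_rfl,
      MvPolynomial.coeff_monomial, if_pos rfl]
  · change MvPolynomial.coeff _ (TopologicalFaceRing.restriction S (basisElement hS r) q.1.1) = 0
    rw [basisElement, TopologicalFaceRing.restriction_of]
    by_cases h : r.1.1 ≤ q.1.1
    · rw [if_pos h, MvPolynomial.coeff_monomial, if_neg]
      intro e
      refine hqr (Subtype.ext (Prod.ext ?_ e.symm))
      refine hS.eq_of_vertexSet_eq le_rfl h ?_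
      rw [← q.2, ← r.2, e]
    · rw [if_neg h, MvPolynomial.coeff_zero]

theorem vertexMonomial_mem_exactMonomials (σ : S) :
    vertexMonomial σ ∈ exactMonomials (vertexSet σ) := by
  rw [vertexMonomial_eq_monomial]
  refine monomial_mem_exactMonomials (Finset.ext fun v => ?_)
  rw [Finsupp.mem_support_iff, mem_vertexSet]
  by_cases h : v.1 ≤ σ
  · simp [vertexExponent_apply_of_le h, h]
  · simp [vertexExponent_apply_of_not_le h, h]

/-- Both face rings have the same image in the product of the polynomial rings of the faces. -/
theorem range_restriction_eq (hS : IsSimplicialPoset S) :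
    (StanleyFaceRing.restriction hS).range = (TopologicalFaceRing.restriction S).range := by
  classical
  apply le_antisymm
  · rintro _ ⟨x, rfl⟩
    obtain ⟨p, rfl⟩ := Ideal.Quotient.mk_surjective x
    induction p using MvPolynomial.induction_on with
    | C a =>
      have h : (MvPolynomial.C a : MvPolynomial S ℤ) = (a : MvPolynomial S ℤ) := by simp
      rw [h, map_intCast, map_intCast]
      exact intCast_mem _ a
    | add p q hp hq => rw [map_add, map_add]; exact add_mem hp hq
    | mul_X p σ hp =>
      rw [map_mul, map_mul]
      refine mul_mem hp ⟨TopologicalFaceRing.of (conePanels S) (vertexSet σ)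
        (componentClass hS rfl ⊗ₜ ⟨_, vertexMonomial_mem_exactMonomials σ⟩), funext fun ω => ?_⟩
      rw [TopologicalFaceRing.restriction_of]
      exact (StanleyFaceRing.restriction_v hS σ ω).symm
  · rintro _ ⟨x, rfl⟩
    have hx : x ∈ AddSubgroup.closure (Set.range (basisElement hS)) := by
      rw [closure_basisElement_eq_top]
      trivial
    induction hx using AddSubgroup.closure_induction with
    | mem x hx =>
      obtain ⟨q, rfl⟩ := hx
      obtain ⟨y, hy⟩ := exists_restriction_eq_monomial hS q.1.2 q.1.1 q.2
      refine ⟨y, funext fun ω => ?_⟩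
      rw [basisElement, TopologicalFaceRing.restriction_of, hy]
    | zero => rw [map_zero]; exact zero_mem _
    | add x y _ _ hx hy => rw [map_add]; exact add_mem hx hy
    | neg x _ hx => rw [map_neg]; exact neg_mem hx

end Inter

/-! ### The isomorphism of the face rings -/

/-- Two rings that embed into a third one with the same image are isomorphic over it. -/
theorem exists_ringEquiv_of_range_eq {A B C : Type*} [Ring A] [Ring B] [Ring C] (f : A →+* C)
    (g : B →+* C) (hf : Function.Injective f) (hg : Function.Injective g)
    (h : f.range = g.range) : ∃ e : A ≃+* B, ∀ a, g (e a) = f a := by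
  let ef : A ≃+* f.range := RingEquiv.ofBijective f.rangeRestrict
    ⟨fun x y hxy => hf (congrArg Subtype.val hxy), f.rangeRestrict_surjective⟩
  let eg : B ≃+* g.range := RingEquiv.ofBijective g.rangeRestrict
    ⟨fun x y hxy => hg (congrArg Subtype.val hxy), g.rangeRestrict_surjective⟩
  refine ⟨(ef.trans (RingEquiv.subringCongr h)).trans eg.symm, fun a => ?_⟩
  exact congrArg Subtype.val (eg.apply_symm_apply ((RingEquiv.subringCongr h) (ef a)))

/-- The image of a chain monomial is supported on the faces that contain the top `ω` of the
chain. -/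
theorem StanleyFaceRing.restriction_prod_pow {S : Type*} [PartialOrder S] [OrderBot S] [Fintype S]
    (hS : IsSimplicialPoset S) {c : Finset (Simplex S)} {ω : Simplex S} {l : Simplex S → ℕ}
    (hω : ω ∈ c) (hle : ∀ τ ∈ c, τ ≤ ω) (hl : ∀ τ ∈ c, 0 < l τ) (η : S) [Decidable (ω.1 ≤ η)] :
    StanleyFaceRing.restriction hS (∏ τ ∈ c, StanleyFaceRing.v τ.1 ^ l τ) η =
      if ω.1 ≤ η then ∏ τ ∈ c, vertexMonomial τ.1 ^ l τ else 0 := by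
  rw [map_prod, Finset.prod_apply]
  simp only [map_pow, Pi.pow_apply, StanleyFaceRing.restriction_v]
  split_ifs with h
  · exact Finset.prod_congr rfl fun τ hτ =>
      by rw [if_pos (show τ.1 ≤ η from (show τ.1 ≤ ω.1 from hle τ hτ).trans h)]
  · exact Finset.prod_eq_zero hω (by rw [if_neg h, zero_pow (hl ω hω).ne'])

theorem prod_vertexMonomial_pow_mem {S : Type*} [PartialOrder S] [OrderBot S] [Fintype S]
    {c : Finset (Simplex S)} {ω : Simplex S} {l : Simplex S → ℕ}
    (hω : ω ∈ c) (hle : ∀ τ ∈ c, τ ≤ ω) (hl : ∀ τ ∈ c, 0 < l τ) :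
    ∏ τ ∈ c, vertexMonomial τ.1 ^ l τ ∈ exactMonomials (vertexSet ω.1) := by
  have h : ∏ τ ∈ c, vertexMonomial τ.1 ^ l τ =
      MvPolynomial.monomial (∑ τ ∈ c, l τ • vertexExponent τ.1) 1 := by
    rw [MvPolynomial.monomial_sum_one]
    refine Finset.prod_congr rfl fun τ _ => ?_
    rw [vertexMonomial_eq_monomial, MvPolynomial.monomial_pow, one_pow]
  rw [h]
  refine monomial_mem_exactMonomials (Finset.ext fun v => ?_)
  rw [Finsupp.mem_support_iff, Finsupp.finsetSum_apply, Ne, Finset.sum_eq_zero_iff,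
    mem_vertexSet]
  simp only [Finsupp.smul_apply, smul_eq_mul, mul_eq_zero]
  constructor
  · intro hv
    by_contra hvω
    refine hv fun τ hτ => Or.inr (vertexExponent_apply_of_not_le fun h => hvω ?_)
    exact h.trans (hle τ hτ)
  · intro hv h0
    rcases h0 ω hω with h0 | h0
    · exact (hl ω hω).ne' h0
    · rw [vertexExponent_apply_of_le hv] at h0
      exact one_ne_zero h0

end FaceSpace

end

theorem mainTheorem12 {S : Type*} [PartialOrder S] [OrderBot S] [Fintype S]
    (hS : FaceSpace.IsSimplicialPoset S) :
    ∃ (ρ : FaceSpace.StanleyFaceRing S ≃+*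
          FaceSpace.TopologicalFaceRing (FaceSpace.conePanels S))
      (e : ∀ σ : FaceSpace.Simplex S, FaceSpace.CohomologyRing
          ((FaceSpace.conePanels S).inter (FaceSpace.vertexSet σ.1))),
      (∀ σ, FaceSpace.IsComponentClass σ (e σ)) ∧
      ∀ (c : Finset (FaceSpace.Simplex S)) (ω : FaceSpace.Simplex S)
        (l : FaceSpace.Simplex S → ℕ),
        IsChain (· ≤ ·) (c : Set (FaceSpace.Simplex S)) → ω ∈ c → (∀ τ ∈ c, τ ≤ ω) →
        (∀ τ ∈ c, 0 < l τ) →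
        ∃ hf : ∏ τ ∈ c, FaceSpace.vertexMonomial τ.1 ^ l τ ∈
            FaceSpace.exactMonomials (FaceSpace.vertexSet ω.1),
          ρ (∏ τ ∈ c, FaceSpace.StanleyFaceRing.v τ.1 ^ l τ) =
            FaceSpace.TopologicalFaceRing.of (FaceSpace.conePanels S)
              (FaceSpace.vertexSet ω.1) (e ω ⊗ₜ ⟨_, hf⟩) := by
  classical
  obtain ⟨ρ, hρ⟩ := FaceSpace.exists_ringEquiv_of_range_eq
    (FaceSpace.StanleyFaceRing.restriction hS)
    (FaceSpace.TopologicalFaceRing.restriction S)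
    (FaceSpace.StanleyFaceRing.restriction_injective hS)
    (FaceSpace.TopologicalFaceRing.restriction_injective hS) (FaceSpace.range_restriction_eq hS)
  refine ⟨ρ, fun σ => FaceSpace.componentClass hS rfl, fun σ τ h => ?_,
    fun c ω l _ hω hle hl => ⟨FaceSpace.prod_vertexMonomial_pow_mem hω hle hl, ?_⟩⟩
  · rw [FaceSpace.restrict_componentClass hS rfl (FaceSpace.face_eq_dualFace τ) h]
    simp only [Subtype.ext_iff]
  · refine FaceSpace.TopologicalFaceRing.restriction_injective hS (funext fun η => ?_)
    rw [hρ, FaceSpace.StanleyFaceRing.restriction_prod_pow hS hω hle hl,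
      FaceSpace.TopologicalFaceRing.restriction_of]
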